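/- Let $G$ be a connected reductive complex algebraic group with Lie algebra $\mathfrak g$, let $T\subset B$ be a maximal torus and a Borel subgroup of $G$, let $\Lambda$ be the character lattice of $T$, $\Lambda^+\subset\Lambda$ the set of dominant weights and $S$ the set of simple roots. For every root $\beta$ let $X_\beta\in\mathfrak g$ be a root vector of weight $\beta$. Let $\lambda_1,\dots,\lambda_s\in\Lambda^+$ be linearly independent dominant weights such that the monoid $\Gamma$ that they span is saturated, that is, $\mathbb Z\Gamma\cap\Lambda^+=\Gamma$. Put $V=V(\lambda_1)\oplus\dots\oplus V(\lambda_s)$, where $V(\lambda_i)$ is the irreducible $G$-module of highest weight $\lambda_i$, choose highest weight vectors $v_{\lambda_i}\in V(\lambda_i)$, and put $v_{\underline\lambda}=v_{\lambda_1}+\dots+v_{\lambda_s}$. The adjoint torus $T_{\mathrm{ad}}=T/Z(G)$ acts on $V$ by $t\cdot v=(\lambda_i-\mu)(t)\,v$ for $v$ in the weight space $V(\lambda_i)_\mu$, and it acts on $V/\mathfrak g.v_{\underline\lambda}$ accordingly; for $v\in V$ write $[v]$ for its class in $V/\mathfrak g.v_{\underline\lambda}$. Let $[v_\gamma]\in V/\mathfrak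 g.v_{\underline\lambda}$ be a (nonzero) $T_{\mathrm{ad}}$-weight vector of weight $\gamma$, with representative $v_\gamma\in\bigoplus_i V(\lambda_i)_{\lambda_i-\gamma}$. Let $\alpha,\delta\in S$ be orthogonal simple roots such that $\delta$ lies in the support of $\gamma$, i.e. $\delta$ has a nonzero coefficient in the expression of $\gamma$ as an integral combination of simple roots. Suppose that $\gamma\neq\delta$, that $\gamma-\delta$ is not a root, and that $[X_\beta v_\gamma]=0$ for all positive roots $\beta\neq\alpha$. Then every $\lambda_i$ is orthogonal to $\delta$. -/

import Mathlib

namespace ReductivePair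

/-!
A connected reductive complex algebraic group `G` with a maximal torus `T` enters through its Lie
algebra `L`, the Cartan subalgebra `H` (the Lie algebra of `T`), and the lattice `Λ` of
differentials of characters of `T` inside the dual of `H`.  A Borel subgroup containing `T` enters
through the simple roots `S`.
-/

section Roots

variable {L : Type*} [LieRing L] [LieAlgebra ℂ L] [FiniteDimensional ℂ L]
  (H : LieSubalgebra ℂ L) [H.IsCartanSubalgebra]

/-- Roots of `L` with respect to `H`: the nonzero weights of `H` on `L`. -/
def IsRoot (β : Module.Dual ℂ H) : Prop :=
  β ≠ 0 ∧ LieAlgebra.rootSpace H β ≠ ⊥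

/-- `h` is the coroot of `β`: it lies in the span of `[L_β, L_{-β}]` and `β h = 2`. -/
def IsCoroot (β : Module.Dual ℂ H) (h : H) : Prop :=
  h ∈ LieAlgebra.corootSpace (β : H → ℂ) ∧ β h = 2

/-- The weight `μ` is orthogonal to the root `β`: it vanishes on the line spanned by the coroot
of `β`. -/
def IsOrthogonal (μ β : Module.Dual ℂ H) : Prop :=
  ∀ h ∈ LieAlgebra.corootSpace (β : H → ℂ), μ h = 0

/-- `S` is an enumeration of a set of simple roots (a base of the root system). -/
structure IsSimpleSystem {ι : Type*} [Fintype ι] (S : ι → Module.Dual ℂ H) : Prop where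
  isRoot : ∀ i, IsRoot H (S i)
  linearIndependent : LinearIndependent ℂ S
  root_eq : ∀ β, IsRoot H β → ∃ n : ι → ℕ, β = ∑ i, n i • S i ∨ β = -∑ i, n i • S i

/-- Positive roots with respect to the simple roots `S`. -/
def IsPositiveRoot {ι : Type*} [Fintype ι] (S : ι → Module.Dual ℂ H)
    (β : Module.Dual ℂ H) : Prop :=
  IsRoot H β ∧ ∃ n : ι → ℕ, β = ∑ i, n i • S i

/-- The support of an element `γ` of the root lattice (a character of the adjoint torus): the simple
roots that occur in `γ` with a nonzero coefficient. -/
def rootSupport {ι : Type*} [Fintype ι] (S : ι → Module.Dual ℂ H)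
    (γ : Module.Dual ℂ H) : Set ι :=
  {i | ∃ n : ι → ℤ, γ = ∑ j, n j • S j ∧ n i ≠ 0}

/-- `Λ` is the character lattice of the maximal torus of a connected reductive group with
Lie algebra `L`: a full lattice in the dual of `H` that contains the roots and takes integral values
on the coroots. -/
structure IsCharacterLattice (Λ : AddSubgroup (Module.Dual ℂ H)) : Prop where
  exists_basis : ∃ b : Module.Basis (Fin (Module.finrank ℂ H)) ℂ (Module.Dual ℂ H),
    Λ = AddSubgroup.closure (Set.range b)
  root_mem : ∀ β, IsRoot H β → β ∈ Λ
  coroot_integral : ∀ β h, IsRoot H β → IsCoroot H β h → ∀ μ ∈ Λ, ∃ m : ℤ, μ h = m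

/-- The set `Λ⁺` of dominant weights. -/
def dominantWeights {ι : Type*} (Λ : AddSubgroup (Module.Dual ℂ H))
    (S : ι → Module.Dual ℂ H) : Set (Module.Dual ℂ H) :=
  {μ | μ ∈ Λ ∧ ∀ i h, IsCoroot H (S i) h → ∃ m : ℕ, μ h = m}

/-- `m` is a highest weight vector of weight `μ`. -/
structure IsHighestWeightVector {ι : Type*} [Fintype ι] (S : ι → Module.Dual ℂ H)
    {M : Type*} [AddCommGroup M] [Module ℂ M] [LieRingModule L M] [LieModule ℂ L M]
    (μ : Module.Dual ℂ H) (m : M) : Prop where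
  ne_zero : m ≠ 0
  mem_weightSpace : m ∈ LieModule.weightSpace M (μ : H → ℂ)
  lie_eq_zero : ∀ β, IsPositiveRoot H S β → ∀ x ∈ LieAlgebra.rootSpace H β, ⁅x, m⁆ = 0

end Roots

/-- The tangent space `L.m = {x.m | x ∈ L}` at `m` of the orbit of `m`. -/
def orbitTangent (L : Type*) [LieRing L] [LieAlgebra ℂ L]
    {M : Type*} [AddCommGroup M] [Module ℂ M] [LieRingModule L M] [LieModule ℂ L M]
    (m : M) : Submodule ℂ M :=
  LinearMap.range ((LieModule.toEnd ℂ L M : L →ₗ[ℂ] Module.End ℂ M).flip m)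

/-- The vector `v_1 + ... + v_s` of `V_1 ⊕ ... ⊕ V_s`. -/
noncomputable def sumVector {s : ℕ} {V : Fin s → Type*}
    [∀ k, AddCommGroup (V k)] [∀ k, Module ℂ (V k)] (v : ∀ k, V k) : DirectSum (Fin s) V :=
  ∑ k, DirectSum.lof ℂ (Fin s) V k (v k)

end ReductivePair

open ReductivePair

set_option linter.unusedSectionVars false

/-! Write v for the sum of the highest weight vectors, u for the representative of the class, and
e_β, f_β, t_β for `eVec`, `fVec`, `tVec`. Suppose some weight is not orthogonal to δ, so t_δ v ≠ 0.
The claim is that u, after subtracting a suitable element of the tangent space, is killed by every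
e_β with δ in the support of β, that is, by the nilradical of the maximal parabolic attached to δ
(`eVec_lie_eq_zero_of_coeff_ne_zero`).

Granting this, let d in H be 1 on δ and 0 on the other simple roots. In an irreducible module, a
nonzero weight vector killed by that nilradical has the top d-eigenvalue
(`exists_nat_of_isIrreducible`). A nonzero component of u and the highest weight vector of the same
summand would both have it, forcing γ(d) = 0, although δ is in the support of γ. So u = 0 and the
class was zero, a contradiction.

For the claim, comparing weights gives e_β u = y.v with y of weight β - γ when β ≠ α. Thus e_β u is
zero unless γ - β is zero or a positive root β', when in the latter case e_β u is a multiple of f_β'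
v. The induction on height splits β = ε + η with δ in the support of ε and η ≠ α, which is possible
because α and δ are orthogonal (`exists_eq_add`). If γ = ε + η + β', the Jacobi identity makes the
coefficients of e_β u and e_β' u opposite (`exists_of_eq_add`). Applying [e_β', e_β], of weight γ,
then gives a multiple of (t_β + t_β')v. This cannot vanish nontrivially, because dominant weights
are nonnegative on positive coroots. When γ is itself a positive root, the same relation shows that
e_γ u is a multiple of t_γ v, and subtracting a multiple of f_γ v arranges e_γ u = 0. -/

namespace ReductivePair

open LieAlgebra LieModule

/-! ### The semisimple quotient of L by its centre -/

section Quotient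

variable {L : Type*} [LieRing L] [LieAlgebra ℂ L]

/-- The quotient map of a Lie algebra by its center. -/
def quotCenter (L : Type*) [LieRing L] [LieAlgebra ℂ L] : L →ₗ⁅ℂ⁆ L ⧸ LieAlgebra.center ℂ L :=
  { (LieAlgebra.center ℂ L).toSubmodule.mkQ with map_lie' := fun {_ _} => rfl }

lemma quotCenter_surjective : Function.Surjective (quotCenter L) :=
  Submodule.mkQ_surjective _

lemma quotCenter_eq_zero {x : L} : quotCenter L x = 0 ↔ x ∈ LieAlgebra.center ℂ L :=
  Submodule.Quotient.mk_eq_zero _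

lemma mem_center_iff {x : L} : x ∈ LieAlgebra.center ℂ L ↔ ∀ y : L, ⁅y, x⁆ = 0 :=
  LieModule.mem_maxTrivSubmodule ℂ L L x

variable [FiniteDimensional ℂ L]

/-- The preimage of an abelian ideal has derived ideal inside the centre, so it is solvable and lies
in the radical, which is the centre. -/
instance [HasCentralRadical ℂ L] : HasTrivialRadical ℂ (L ⧸ LieAlgebra.center ℂ L) := by
  rw [hasTrivialRadical_iff_no_abelian_ideals]
  intro I hI
  have hsolv : IsSolvable (I.comap (quotCenter L)) := by
    refine IsSolvable.mk (R := ℂ) (k := 2) ?_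
    rw [LieIdeal.derivedSeries_eq_bot_iff]
    have h1 : derivedSeriesOfIdeal ℂ L 1 (I.comap (quotCenter L)) ≤ LieAlgebra.center ℂ L := by
      rw [derivedSeriesOfIdeal_succ, derivedSeriesOfIdeal_zero, LieSubmodule.lieIdeal_oper_eq_span,
        LieSubmodule.lieSpan_le]
      rintro _ ⟨⟨x, hx⟩, ⟨y, hy⟩, rfl⟩
      rw [SetLike.mem_coe, ← quotCenter_eq_zero]
      simp only [LieHom.map_lie]
      have := hI.trivial ⟨quotCenter L x, LieIdeal.mem_comap.1 hx⟩
        ⟨quotCenter L y, LieIdeal.mem_comap.1 hy⟩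
      exact congrArg Subtype.val this
    rw [derivedSeriesOfIdeal_succ, eq_bot_iff, LieSubmodule.lieIdeal_oper_eq_span,
        LieSubmodule.lieSpan_le]
    rintro _ ⟨⟨x, hx⟩, ⟨y, hy⟩, rfl⟩
    exact mem_center_iff.1 (h1 hy) x
  have hle := (LieIdeal.solvable_iff_le_radical ℂ L _).1 hsolv
  rw [HasCentralRadical.radical_eq_center] at hle
  rw [eq_bot_iff]
  intro y hy
  obtain ⟨x, rfl⟩ := quotCenter_surjective y
  exact quotCenter_eq_zero.2 (hle (LieIdeal.mem_comap.2 hy))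

variable (H : LieSubalgebra ℂ L) [H.IsCartanSubalgebra]

lemma center_le_cartan {x : L} (hx : x ∈ LieAlgebra.center ℂ L) : x ∈ H := by
  rw [← LieSubalgebra.IsCartanSubalgebra.self_normalizing (H := H),
    LieSubalgebra.mem_normalizer_iff']
  intro y _
  rw [mem_center_iff.1 hx]
  exact H.zero_mem

instance : (H.map (quotCenter L)).IsCartanSubalgebra where
  nilpotent := by
    let f : H →ₗ⁅ℂ⁆ H.map (quotCenter L) :=
      { toFun := fun x => ⟨quotCenter L x, x, x.2, rfl⟩
        map_add' := fun x y => Subtype.ext (map_add (quotCenter L) (x : L) y)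
        map_smul' := fun c x => Subtype.ext (map_smul (quotCenter L) c (x : L))
        map_lie' := fun {x y} => Subtype.ext (LieHom.map_lie (quotCenter L) (x : L) y) }
    have : Function.Surjective f := by
      rintro ⟨_, x, hx, rfl⟩
      exact ⟨⟨x, hx⟩, rfl⟩
    exact this.lieAlgebra_isNilpotent
  self_normalizing := by
    refine le_antisymm ?_ (LieSubalgebra.le_normalizer _)
    intro y hy
    obtain ⟨x, rfl⟩ := quotCenter_surjective y
    refine ⟨x, ?_, rfl⟩
    rw [← LieSubalgebra.IsCartanSubalgebra.self_normalizing (H := H)]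
    rw [LieSubalgebra.mem_normalizer_iff'] at hy
    refine (LieSubalgebra.mem_normalizer_iff' _ _).2 ?_
    intro z hz
    obtain ⟨w, hw, hw'⟩ := hy (quotCenter L z) ⟨z, hz, rfl⟩
    have : quotCenter L (⁅z, x⁆ - w) = 0 := by
      rw [map_sub, LieHom.map_lie, sub_eq_zero]
      exact hw'.symm
    have := H.add_mem (center_le_cartan H (quotCenter_eq_zero.1 this)) hw
    simpa using this

variable {H}

lemma quotCenter_mem_rootSpace {χ : H → ℂ} {χ' : H.map (quotCenter L) → ℂ}
    (hχ : ∀ h : H, χ' ⟨quotCenter L h, h, h.2, rfl⟩ = χ h) {x : L} (hx : x ∈ rootSpace H χ) :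
    quotCenter L x ∈ rootSpace (H.map (quotCenter L)) χ' := by
  rw [LieModule.mem_genWeightSpace] at hx ⊢
  rintro ⟨_, h, hh, rfl⟩
  obtain ⟨k, hk⟩ := hx ⟨h, hh⟩
  refine ⟨k, ?_⟩
  have key : ∀ (k : ℕ) (z : L), ((toEnd ℂ (H.map (quotCenter L)) (L ⧸ LieAlgebra.center ℂ L)
      ⟨quotCenter L h, h, hh, rfl⟩ - χ' ⟨quotCenter L h, h, hh, rfl⟩ • 1) ^ k) (quotCenter L z) =
      quotCenter L (((toEnd ℂ H L ⟨h, hh⟩ - χ ⟨h, hh⟩ • 1) ^ k) z) := by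
    intro k
    induction k with
    | zero => simp
    | succ k ih =>
      intro z
      rw [pow_succ, pow_succ, Module.End.mul_apply, Module.End.mul_apply, ← ih]
      congr 1
      have := hχ ⟨h, hh⟩
      simp only [LinearMap.sub_apply, LinearMap.smul_apply, Module.End.one_apply, map_sub,
        map_smul]
      rw [this]
      rfl
  have := key k x
  rw [hk, map_zero] at this
  exact this

/-- A central h acts by zero on L, so its generalized eigenvalue β(h) on x is zero. Hence β is
constant on the fibres of the quotient map and may be evaluated at any chosen preimage. -/
lemma exists_weight_quotCenter {β : Module.Dual ℂ H} {x : L} (hx : x ∈ rootSpace H β)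
    (hx0 : x ≠ 0) : ∃ χ' : H.map (quotCenter L) → ℂ,
      ∀ h : H, χ' ⟨quotCenter L h, h, h.2, rfl⟩ = β h := by
  have hz : ∀ h : H, (h : L) ∈ LieAlgebra.center ℂ L → β h = 0 := by
    intro h hh
    rw [LieModule.mem_genWeightSpace] at hx
    obtain ⟨k, hk⟩ := hx h
    have : toEnd ℂ H L h = 0 := by
      ext y
      have h1 := mem_center_iff.1 hh y
      rw [← lie_skew, neg_eq_zero] at h1
      exact h1
    rw [this, zero_sub, ← neg_smul, smul_pow, one_pow, LinearMap.smul_apply,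
      Module.End.one_apply, smul_eq_zero] at hk
    exact neg_eq_zero.1 (eq_zero_of_pow_eq_zero (hk.resolve_right hx0))
  refine ⟨fun y => β ⟨y.2.choose, y.2.choose_spec.1⟩, fun h => ?_⟩
  have h2 : ∀ z (hz' : z ∈ H), quotCenter L z = quotCenter L h → β ⟨z, hz'⟩ = β h := by
    intro z hz' he
    rw [← sub_eq_zero, ← map_sub]
    refine hz _ (quotCenter_eq_zero.1 ?_)
    simp [he]
  exact h2 _ _ (Exists.choose_spec (⟨h, h.2, rfl⟩ : (quotCenter L h) ∈ H.map (quotCenter L))).2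

lemma center_mem_rootSpace_zero {x : L} (hx : x ∈ LieAlgebra.center ℂ L) :
    x ∈ rootSpace H (0 : H → ℂ) := by
  rw [rootSpace_zero_eq ℂ L H]
  exact center_le_cartan H hx

lemma quotCenter_ne_zero {β : Module.Dual ℂ H} (hβ : β ≠ 0) {x : L} (hx : x ∈ rootSpace H β)
    (hx0 : x ≠ 0) : quotCenter L x ≠ 0 := by
  intro h
  have h1 : x ∈ rootSpace H (0 : H → ℂ) := center_mem_rootSpace_zero (quotCenter_eq_zero.1 h)
  have h2 : (β : H → ℂ) ≠ 0 := fun h => hβ (by ext y; exact congrFun h y)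
  have := (LieModule.disjoint_genWeightSpace ℂ H L h2)
  rw [← LieSubmodule.disjoint_toSubmodule, Submodule.disjoint_def] at this
  exact hx0 (this x hx h1)

end Quotient

/-- On H the Killing form is the sum of the squares of the roots, and roots are integral on coroots.
The term of w itself is 4, so the sum is positive. -/
lemma exists_killingForm_coroot_eq {g : Type*} [LieRing g] [LieAlgebra ℂ g]
    [FiniteDimensional ℂ g] [IsKilling ℂ g] {H : LieSubalgebra ℂ g} [H.IsCartanSubalgebra]
    {w : Weight ℂ H g} (hw : w.IsNonZero) :
    ∃ q : ℝ, 0 < q ∧ killingForm ℂ g (IsKilling.coroot w) (IsKilling.coroot w) = q := by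
  have h4 : killingForm ℂ g (IsKilling.coroot w) (IsKilling.coroot w) =
      ∑ α ∈ H.root, α (IsKilling.coroot w) * α (IsKilling.coroot w) := by
    have := LinearMap.congr_fun₂ (IsKilling.restrict_killingForm_eq_sum (K := ℂ) (H := H))
      (IsKilling.coroot w) (IsKilling.coroot w)
    rw [LinearMap.BilinForm.restrict_apply] at this
    refine this.trans ?_
    simp only [LinearMap.sum_apply, LinearMap.smulRight_apply, LinearMap.smul_apply, smul_eq_mul]
    rfl
  have hn : ∀ α : Weight ℂ H g, ∃ n : ℤ, α (IsKilling.coroot w) = n :=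
    fun α => ⟨_, IsKilling.apply_coroot_eq_cast w α⟩
  choose n hn using hn
  have hnw : n w = 2 := by
    have := hn w
    rw [IsKilling.root_apply_coroot hw] at this
    exact_mod_cast this.symm
  refine ⟨∑ α ∈ H.root, (n α : ℝ) * n α, ?_, ?_⟩
  · exact Finset.sum_pos' (fun i _ => mul_self_nonneg _)
      ⟨w, by simpa using hw, by rw [hnw]; norm_num⟩
  · rw [h4]
    simp [hn]

/-! ### Root spaces, the invariant form and sl₂-triples -/

section RootSpaces

variable {L : Type*} [LieRing L] [LieAlgebra ℂ L] [FiniteDimensional ℂ L]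
  {H : LieSubalgebra ℂ L} [H.IsCartanSubalgebra]

lemma exists_dual_eq_of_mem_genWeightSpace {M : Type*} [AddCommGroup M] [Module ℂ M]
    [LieRingModule L M] [LieModule ℂ L M] [FiniteDimensional ℂ M] {χ : H → ℂ} {m : M}
    (hm : m ∈ genWeightSpace M χ) (hm0 : m ≠ 0) : ∃ β : Module.Dual ℂ H, (β : H → ℂ) = χ := by
  let w : Weight ℂ H M := ⟨χ, fun h => hm0 (by rw [h] at hm; simpa using hm)⟩
  exact ⟨w.toLinear, rfl⟩

lemma lie_mem_rootSpace {β β' : Module.Dual ℂ H} {x y : L} (hx : x ∈ rootSpace H β)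
    (hy : y ∈ rootSpace H β') : ⁅x, y⁆ ∈ rootSpace H (β + β' : Module.Dual ℂ H) :=
  lie_mem_genWeightSpace_of_mem_genWeightSpace hx hy

lemma isRoot_of_mem {β : Module.Dual ℂ H} (hβ : β ≠ 0) {x : L} (hx : x ∈ rootSpace H β)
    (hx0 : x ≠ 0) : IsRoot H β :=
  ⟨hβ, fun h => hx0 (by rw [h] at hx; simpa using hx)⟩

lemma exists_mem_of_isRoot {β : Module.Dual ℂ H} (hβ : IsRoot H β) :
    ∃ x ∈ rootSpace H β, x ≠ 0 := by
  by_contra! h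
  exact hβ.2 ((LieSubmodule.eq_bot_iff _).2 h)

lemma eq_zero_of_not_isRoot {β : Module.Dual ℂ H} (hβ : β ≠ 0) (h : ¬ IsRoot H β) {x : L}
    (hx : x ∈ rootSpace H β) : x = 0 := by
  by_contra hx0
  exact h (isRoot_of_mem hβ hx hx0)

lemma mem_cartan_of_mem_rootSpace_zero {x : L} (hx : x ∈ rootSpace H (0 : Module.Dual ℂ H)) :
    x ∈ H := by
  have : x ∈ rootSpace H (0 : H → ℂ) := hx
  rw [rootSpace_zero_eq ℂ L H] at this
  exact this

lemma lie_mem_cartan {β : Module.Dual ℂ H} {x y : L} (hx : x ∈ rootSpace H β)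
    (hy : y ∈ rootSpace H (-β : Module.Dual ℂ H)) : ⁅x, y⁆ ∈ H := by
  refine mem_cartan_of_mem_rootSpace_zero ?_
  have := lie_mem_rootSpace hx hy
  rwa [add_neg_cancel] at this

variable [HasCentralRadical ℂ L]

/-- The image of a root of `L` as a weight of the semisimple quotient. -/
lemma exists_weight {β : Module.Dual ℂ H} (hβ : β ≠ 0) {x : L} (hx : x ∈ rootSpace H β)
    (hx0 : x ≠ 0) : ∃ w : Weight ℂ (H.map (quotCenter L)) (L ⧸ LieAlgebra.center ℂ L),
      w.IsNonZero ∧ ∀ h : H, w ⟨quotCenter L h, h, h.2, rfl⟩ = β h := by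
  obtain ⟨χ, hχ⟩ := exists_weight_quotCenter hx hx0
  refine ⟨⟨χ, fun h => quotCenter_ne_zero hβ hx hx0 ?_⟩, fun h => hβ ?_, hχ⟩
  · have := quotCenter_mem_rootSpace hχ hx
    rw [rootSpace, h] at this
    simpa using this
  · ext y
    rw [← hχ]
    exact congrFun h _

lemma quotCenter_mem {β : Module.Dual ℂ H}
    {w : Weight ℂ (H.map (quotCenter L)) (L ⧸ LieAlgebra.center ℂ L)}
    (hw : ∀ h : H, w ⟨quotCenter L h, h, h.2, rfl⟩ = β h) {x : L} (hx : x ∈ rootSpace H β) :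
    quotCenter L x ∈ rootSpace (H.map (quotCenter L)) w :=
  quotCenter_mem_rootSpace hw hx

lemma quotCenter_mem_neg {β : Module.Dual ℂ H}
    {w : Weight ℂ (H.map (quotCenter L)) (L ⧸ LieAlgebra.center ℂ L)}
    (hw : ∀ h : H, w ⟨quotCenter L h, h, h.2, rfl⟩ = β h) {x : L}
    (hx : x ∈ rootSpace H (-β : Module.Dual ℂ H)) :
    quotCenter L x ∈ rootSpace (H.map (quotCenter L)) (-w : (H.map (quotCenter L)) → ℂ) :=
  quotCenter_mem_rootSpace (fun h => by simp [hw]) hx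

lemma eq_of_quotCenter_eq {β : Module.Dual ℂ H} (hβ : β ≠ 0) {x y : L} (hx : x ∈ rootSpace H β)
    (hy : y ∈ rootSpace H β) (h : quotCenter L x = quotCenter L y) : x = y := by
  by_contra hne
  exact quotCenter_ne_zero hβ (sub_mem hx hy) (sub_ne_zero.2 hne) (by rw [map_sub, h, sub_self])

/-- Root vectors are eigenvectors of the Cartan subalgebra. -/
lemma lie_eq_smul {β : Module.Dual ℂ H} (hβ : β ≠ 0) {x : L} (hx : x ∈ rootSpace H β) (h : H) :
    ⁅(h : L), x⁆ = β h • x := by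
  by_cases hx0 : x = 0
  · simp [hx0]
  obtain ⟨w, -, hw⟩ := exists_weight hβ hx hx0
  refine eq_of_quotCenter_eq hβ (LieSubmodule.lie_mem (rootSpace H β) (x := h) hx)
    ((rootSpace H β).smul_mem _ hx) ?_
  have := IsKilling.lie_eq_smul_of_mem_rootSpace (quotCenter_mem hw hx)
    ⟨quotCenter L h, h, h.2, rfl⟩
  rw [hw] at this
  rw [LieHom.map_lie, map_smul]
  exact this

lemma exists_eq_smul {β : Module.Dual ℂ H} (hβ : β ≠ 0) {x y : L} (hx : x ∈ rootSpace H β)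
    (hx0 : x ≠ 0) (hy : y ∈ rootSpace H β) : ∃ c : ℂ, y = c • x := by
  obtain ⟨w, hw0, hw⟩ := exists_weight hβ hx hx0
  obtain ⟨c, hc⟩ := (finrank_eq_one_iff_of_nonzero'
    (⟨quotCenter L x, quotCenter_mem hw hx⟩ : rootSpace (H.map (quotCenter L)) w)
    (fun h => quotCenter_ne_zero hβ hx hx0 (congrArg Subtype.val h))).1
    (IsKilling.finrank_rootSpace_eq_one w hw0) ⟨quotCenter L y, quotCenter_mem hw hy⟩
  refine ⟨c, eq_of_quotCenter_eq hβ hy ((rootSpace H β).smul_mem _ hx) ?_⟩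
  rw [map_smul]
  exact (congrArg Subtype.val hc).symm

variable (L) in
/-- The Killing form of the semisimple quotient of `L`, as a form on `L`. -/
noncomputable def adjForm : LinearMap.BilinForm ℂ L :=
  (killingForm ℂ (L ⧸ LieAlgebra.center ℂ L)).compl₁₂
    (quotCenter L : L →ₗ[ℂ] L ⧸ LieAlgebra.center ℂ L) (quotCenter L : L →ₗ[ℂ] _)

lemma adjForm_apply (x y : L) :
    adjForm L x y = killingForm ℂ (L ⧸ LieAlgebra.center ℂ L) (quotCenter L x) (quotCenter L y) :=
  rfl

lemma adjForm_lie (x y z : L) : adjForm L ⁅x, y⁆ z = adjForm L x ⁅y, z⁆ := by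
  simp only [adjForm_apply, LieHom.map_lie, LieModule.traceForm_apply_lie_apply]

/-- The form pairs the root space of β only with that of -β. A vector orthogonal to the latter would
map into the kernel of the nondegenerate Killing form of the quotient. -/
lemma exists_adjForm_eq_one {β : Module.Dual ℂ H} (hβ : β ≠ 0) {x : L} (hx : x ∈ rootSpace H β)
    (hx0 : x ≠ 0) : ∃ y ∈ rootSpace H (-β : Module.Dual ℂ H), adjForm L x y = 1 := by
  suffices ∃ y ∈ rootSpace H (-β : Module.Dual ℂ H), adjForm L x y ≠ 0 by
    obtain ⟨y, hy, hxy⟩ := this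
    exact ⟨(adjForm L x y)⁻¹ • y, (rootSpace H _).smul_mem _ hy, by simp [hxy]⟩
  by_contra! hcon
  refine quotCenter_ne_zero hβ hx hx0 ?_
  have hker : quotCenter L x ∈ LinearMap.ker (killingForm ℂ (L ⧸ LieAlgebra.center ℂ L)) := by
    rw [LinearMap.mem_ker]
    ext z
    obtain ⟨y, rfl⟩ := quotCenter_surjective z
    change adjForm L x y = 0
    have hy : y ∈ ⨆ χ, rootSpace H χ := by simp [iSup_genWeightSpace_eq_top ℂ H L]
    induction hy using LieSubmodule.iSup_induction' with
    | mem χ y hy =>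
      by_cases hy0 : y = 0
      · simp [hy0]
      obtain ⟨χ, rfl⟩ := exists_dual_eq_of_mem_genWeightSpace hy hy0
      by_cases hχ : χ = -β
      · subst hχ
        exact hcon y hy
      obtain ⟨β', hβ'⟩ := exists_weight_quotCenter hx hx0
      obtain ⟨χ', hχ'⟩ := exists_weight_quotCenter hy hy0
      refine LieAlgebra.killingForm_apply_eq_zero_of_mem_rootSpace_of_add_ne_zero ℂ _ _
        (quotCenter_mem_rootSpace hβ' hx) (quotCenter_mem_rootSpace hχ' hy) fun h => hχ ?_
      rw [eq_neg_iff_add_eq_zero, add_comm]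
      ext t
      have := congrFun h ⟨quotCenter L t, t, t.2, rfl⟩
      simp only [Pi.add_apply, hβ', hχ'] at this
      exact this
    | zero => simp
    | add => simp_all
  simpa using hker

lemma IsRoot.neg {β : Module.Dual ℂ H} (hβ : IsRoot H β) : IsRoot H (-β) := by
  obtain ⟨x, hx, hx0⟩ := exists_mem_of_isRoot hβ
  obtain ⟨y, hy, hxy⟩ := exists_adjForm_eq_one hβ.1 hx hx0
  refine isRoot_of_mem (neg_ne_zero.2 hβ.1) hy ?_
  rintro rfl
  simp at hxy

lemma exists_sl2 {β : Module.Dual ℂ H} (hβ : β ≠ 0) {x : L} (hx : x ∈ rootSpace H β)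
    (hx0 : x ≠ 0) : ∃ (h : H) (f : L), f ∈ rootSpace H (-β : Module.Dual ℂ H) ∧
      IsSl2Triple (h : L) x f ∧ β h = 2 ∧ ∃ q : ℝ, 0 < q ∧ adjForm L x f = q := by
  obtain ⟨w, hw0, hw⟩ := exists_weight hβ hx hx0
  obtain ⟨y, hy, hxy⟩ := exists_adjForm_eq_one hβ hx hx0
  set t : H := ⟨⁅x, y⁆, lie_mem_cartan hx hy⟩ with ht
  have hβt : β t ≠ 0 := by
    have h1 := IsKilling.lie_eq_killingForm_smul_of_mem_rootSpace_of_mem_rootSpace_neg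
      (quotCenter_mem hw hx) (quotCenter_mem_neg hw hy)
    rw [← adjForm_apply, hxy, one_smul] at h1
    have h2 : (⟨quotCenter L t, t, t.2, rfl⟩ : H.map (quotCenter L)) =
        (IsKilling.cartanEquivDual (H.map (quotCenter L))).symm w := by
      refine Subtype.ext ?_
      rw [← h1]
      exact LieHom.map_lie _ _ _
    rw [← hw, h2]
    exact IsKilling.root_apply_cartanEquivDual_symm_ne_zero hw0
  have h2 : β ((2 / β t) • t) = 2 := by simp [hβt]
  have hf : (2 / β t) • y ∈ rootSpace H (-β : Module.Dual ℂ H) := (rootSpace H _).smul_mem _ hy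
  have hx2 : ⁅(((2 / β t) • t : H) : L), x⁆ = (2 : ℂ) • x := by rw [lie_eq_smul hβ hx, h2]
  have hf2 : ⁅(((2 / β t) • t : H) : L), (2 / β t) • y⁆ = -((2 : ℂ) • (2 / β t) • y) := by
    rw [lie_eq_smul (neg_ne_zero.2 hβ) hf, LinearMap.neg_apply, h2, neg_smul]
  have hsl : IsSl2Triple (((2 / β t) • t : H) : L) x ((2 / β t) • y) :=
    { h_ne_zero := by
        intro h
        rw [h, zero_lie] at hx2
        exact hx0 ((smul_eq_zero.1 hx2.symm).resolve_left two_ne_zero)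
      lie_e_f := by rw [lie_smul]; rfl
      lie_h_e_nsmul := by rw [hx2, two_smul, two_smul]
      lie_h_f_nsmul := by rw [hf2, two_smul, two_smul] }
  refine ⟨(2 / β t) • t, (2 / β t) • y, hf, hsl, h2, ?_⟩
  set h : H := (2 / β t) • t with hh
  set f : L := (2 / β t) • y with hf'
  have hx0' := quotCenter_ne_zero hβ hx hx0
  have hsl' : IsSl2Triple (quotCenter L h) (quotCenter L x) (quotCenter L f) :=
    { h_ne_zero := by
        intro h0
        have := congrArg (quotCenter L) hx2
        rw [LieHom.map_lie, h0, zero_lie, map_smul] at this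
        exact hx0' ((smul_eq_zero.1 this.symm).resolve_left two_ne_zero)
      lie_e_f := by rw [← LieHom.map_lie, hsl.lie_e_f]
      lie_h_e_nsmul := by rw [← LieHom.map_lie, hsl.lie_h_e_nsmul, map_nsmul]
      lie_h_f_nsmul := by rw [← LieHom.map_lie, hsl.lie_h_f_nsmul, map_neg, map_nsmul] }
  have hco := hsl'.h_eq_coroot hw0 (quotCenter_mem hw hx) (quotCenter_mem_neg hw hf)
  -- Invariance of the form together with h = [x, f] and [h, f] = -2f; this turns positivity on the
  -- coroot into positivity of the pairing of x with f.
  have h3 : adjForm L h h = 2 * adjForm L x f := by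
    conv_lhs => rw [← hsl.lie_e_f, adjForm_lie, hsl.lie_e_f]
    rw [← lie_skew, hf2]
    simp
  obtain ⟨q, hq, hqw⟩ := exists_killingForm_coroot_eq hw0
  refine ⟨q / 2, half_pos hq, ?_⟩
  rw [adjForm_apply, hco, hqw] at h3
  push_cast
  rw [h3]
  ring

end RootSpaces

/-! ### Brackets of root vectors and structure constants -/

section RootStrings

variable {L : Type*} [LieRing L] [LieAlgebra ℂ L] [FiniteDimensional ℂ L]
  {H : LieSubalgebra ℂ L} [H.IsCartanSubalgebra] [HasCentralRadical ℂ L]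

lemma rootSpace_congr {β β' : Module.Dual ℂ H} (h : β = β') {x : L} (hx : x ∈ rootSpace H β) :
    x ∈ rootSpace H β' := h ▸ hx

/-- A nonzero weight vector killed by `x` has a nonnegative integral weight on the coroot. -/
lemma exists_nat_of_lie_eq_zero {M : Type*} [AddCommGroup M] [Module ℂ M] [LieRingModule L M]
    [LieModule ℂ L M] [FiniteDimensional ℂ M] {h x f : L} (hsl : IsSl2Triple h x f) {m : M}
    (hm0 : m ≠ 0) {μ : ℂ} (hm : ⁅h, m⁆ = μ • m) (hx : ⁅x, m⁆ = 0) : ∃ n : ℕ, μ = n := by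
  have P : hsl.HasPrimitiveVectorWith m μ := ⟨hm0, hm, hx⟩
  exact P.exists_nat

lemma lie_eq_zero_of_weight_zero {M : Type*} [AddCommGroup M] [Module ℂ M] [LieRingModule L M]
    [LieModule ℂ L M] [FiniteDimensional ℂ M] {h x f : L} (hsl : IsSl2Triple h x f) {m : M}
    (hm : ⁅h, m⁆ = 0) (hx : ⁅x, m⁆ = 0) : ⁅f, m⁆ = 0 := by
  by_cases hm0 : m = 0
  · simp [hm0]
  have P : hsl.HasPrimitiveVectorWith m (0 : ℂ) := ⟨hm0, by simpa using hm, hx⟩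
  simpa using P.pow_toEnd_f_eq_zero_of_eq_nat (n := 0) (by simp)

/-- If [x, y] = 0, then y is primitive for the sl₂-triple of x, so β'(h) ≥ 0. By invariance of the
form a vector of weight -(β + β') is also killed by x, so -(2 + β'(h)) ≥ 0, which is absurd. -/
lemma lie_ne_zero {β β' : Module.Dual ℂ H} (hβ : β ≠ 0) (hβ' : β' ≠ 0) (hadd : IsRoot H (β + β'))
    {x y : L} (hx : x ∈ rootSpace H β) (hx0 : x ≠ 0) (hy : y ∈ rootSpace H β') (hy0 : y ≠ 0) :
    ⁅x, y⁆ ≠ 0 := by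
  intro hxy
  obtain ⟨h, f, -, hsl, hh, -⟩ := exists_sl2 hβ hx hx0
  obtain ⟨n, hn⟩ := exists_nat_of_lie_eq_zero hsl hy0 (lie_eq_smul hβ' hy h) hxy
  obtain ⟨z, hz, hz0⟩ := exists_mem_of_isRoot hadd.neg
  have hxz : ⁅x, z⁆ ∈ rootSpace H (-β' : Module.Dual ℂ H) :=
    rootSpace_congr (by abel) (lie_mem_rootSpace hx hz)
  have hxz0 : ⁅x, z⁆ = 0 := by
    by_contra h0
    obtain ⟨y', hy', h1⟩ := exists_adjForm_eq_one (neg_ne_zero.2 hβ') hxz h0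
    obtain ⟨c, rfl⟩ := exists_eq_smul hβ' hy hy0 (rootSpace_congr (neg_neg _) hy')
    rw [map_smul, ← lie_skew, map_neg, LinearMap.neg_apply, adjForm_lie, hxy] at h1
    simp at h1
  obtain ⟨m, hm⟩ := exists_nat_of_lie_eq_zero hsl hz0 (lie_eq_smul hadd.neg.1 hz h) hxz0
  rw [LinearMap.neg_apply, LinearMap.add_apply, hh, hn, neg_eq_iff_add_eq_zero] at hm
  have : 2 + n + m = 0 := by exact_mod_cast hm
  omega

/-- A root vector for the root `β`. -/
noncomputable def eVec (β : Module.Dual ℂ H) : L :=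
  open Classical in if h : IsRoot H β then (exists_mem_of_isRoot h).choose else 0

lemma eVec_mem {β : Module.Dual ℂ H} (h : IsRoot H β) : eVec β ∈ rootSpace H β := by
  rw [eVec, dif_pos h]
  exact (exists_mem_of_isRoot h).choose_spec.1

lemma eVec_ne_zero {β : Module.Dual ℂ H} (h : IsRoot H β) : eVec β ≠ 0 := by
  rw [eVec, dif_pos h]
  exact (exists_mem_of_isRoot h).choose_spec.2

/-- The root vector for `-β` dual to `eVec β`. -/
noncomputable def fVec (β : Module.Dual ℂ H) : L :=
  open Classical in if h : IsRoot H β then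
    (exists_adjForm_eq_one h.1 (eVec_mem h) (eVec_ne_zero h)).choose else 0

lemma fVec_mem {β : Module.Dual ℂ H} (h : IsRoot H β) :
    fVec β ∈ rootSpace H (-β : Module.Dual ℂ H) := by
  rw [fVec, dif_pos h]
  exact (exists_adjForm_eq_one h.1 (eVec_mem h) (eVec_ne_zero h)).choose_spec.1

lemma adjForm_eVec_fVec {β : Module.Dual ℂ H} (h : IsRoot H β) :
    adjForm L (eVec β) (fVec β) = 1 := by
  rw [fVec, dif_pos h]
  exact (exists_adjForm_eq_one h.1 (eVec_mem h) (eVec_ne_zero h)).choose_spec.2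

lemma fVec_ne_zero {β : Module.Dual ℂ H} (h : IsRoot H β) : fVec β ≠ 0 := by
  intro h0
  have := adjForm_eVec_fVec h
  simp [h0] at this

/-- The element of the Cartan subalgebra dual to the root `β`. -/
noncomputable def tVec (β : Module.Dual ℂ H) : L := ⁅eVec β, fVec β⁆

lemma eq_smul_eVec {β : Module.Dual ℂ H} (h : IsRoot H β) {x : L} (hx : x ∈ rootSpace H β) :
    ∃ c : ℂ, x = c • eVec β :=
  exists_eq_smul h.1 (eVec_mem h) (eVec_ne_zero h) hx

lemma eq_smul_fVec {β : Module.Dual ℂ H} (h : IsRoot H β) {x : L}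
    (hx : x ∈ rootSpace H (-β : Module.Dual ℂ H)) : ∃ c : ℂ, x = c • fVec β :=
  exists_eq_smul h.neg.1 (fVec_mem h) (fVec_ne_zero h) hx

/-- Because each f is dual to its e under the invariant form, one constant N governs all three
brackets up to sign; the Jacobi identity then makes t additive. -/
lemma lie_eVec_fVec_add {ε η : Module.Dual ℂ H} (hε : IsRoot H ε) (hη : IsRoot H η)
    (h : IsRoot H (ε + η)) : ∃ N : ℂ, N ≠ 0 ∧ ⁅eVec ε, eVec η⁆ = N • eVec (ε + η) ∧
      ⁅eVec ε, fVec (ε + η)⁆ = -N • fVec η ∧ ⁅eVec η, fVec (ε + η)⁆ = N • fVec ε ∧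
      tVec (ε + η) = tVec ε + tVec η := by
  obtain ⟨N, hN⟩ := eq_smul_eVec h (lie_mem_rootSpace (eVec_mem hε) (eVec_mem hη))
  have hN0 : N ≠ 0 := by
    rintro rfl
    exact lie_ne_zero hε.1 hη.1 h (eVec_mem hε) (eVec_ne_zero hε) (eVec_mem hη) (eVec_ne_zero hη)
      (by rw [hN, zero_smul])
  obtain ⟨c, hc⟩ := eq_smul_fVec hη (rootSpace_congr (by abel)
    (lie_mem_rootSpace (eVec_mem hε) (fVec_mem h)))
  obtain ⟨d, hd⟩ := eq_smul_fVec hε (rootSpace_congr (by abel)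
    (lie_mem_rootSpace (eVec_mem hη) (fVec_mem h)))
  have hcN : c = -N := by
    have h1 : adjForm L (eVec η) (c • fVec η) = c := by simp [adjForm_eVec_fVec hη]
    rw [← h1, ← hc, ← adjForm_lie, ← lie_skew, hN]
    simp [adjForm_eVec_fVec h]
  have hdN : d = N := by
    have h1 : adjForm L (eVec ε) (d • fVec ε) = d := by simp [adjForm_eVec_fVec hε]
    rw [← h1, ← hd, ← adjForm_lie, hN]
    simp [adjForm_eVec_fVec h]
  subst hcN hdN
  refine ⟨d, hN0, hN, hc, hd, ?_⟩
  have h2 : d • tVec (ε + η) = d • (tVec ε + tVec η) := by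
    have := lie_lie (eVec ε) (eVec η) (fVec (ε + η))
    rw [hN, hc, hd, smul_lie, lie_smul, lie_smul] at this
    simpa [tVec, smul_add] using this
  exact smul_right_injective L hN0 h2

end RootStrings

/-! ### Simple roots, heights and supports -/

section SimpleSystem

variable {L : Type*} [LieRing L] [LieAlgebra ℂ L] [FiniteDimensional ℂ L]
  {H : LieSubalgebra ℂ L} [H.IsCartanSubalgebra] 
  {ι : Type*} [Fintype ι] {S : ι → Module.Dual ℂ H}

/-- Provides the two grading elements used below: one with value 1 on every simple root, measuring
height, and one reading off the coefficient of δ. -/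
lemma IsSimpleSystem.exists_apply_eq (hS : IsSimpleSystem H S) (c : ι → ℂ) :
    ∃ h : H, ∀ j, S j h = c j := by
  obtain ⟨φ, hφ⟩ : ∃ φ : Module.Dual ℂ (Module.Dual ℂ H), ∀ j, φ (S j) = c j := by
    let b := Module.Basis.extend hS.linearIndependent.linearIndepOn_id
    have hmem : ∀ j, S j ∈ hS.linearIndependent.linearIndepOn_id.extend (Set.subset_univ _) :=
      fun j => Module.Basis.subset_extend _ ⟨j, rfl⟩
    refine ⟨b.constr ℂ fun x => open Classical in if hx : ∃ j, S j = x then c hx.choose else 0,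
      fun j => ?_⟩
    have hb : b ⟨S j, hmem j⟩ = S j := Module.Basis.extend_apply_self _ _
    conv_lhs => rw [← hb]
    rw [Module.Basis.constr_basis]
    have hx : ∃ i, S i = S j := ⟨j, rfl⟩
    rw [dif_pos hx]
    congr 1
    exact hS.linearIndependent.injective hx.choose_spec
  refine ⟨(Module.evalEquiv ℂ H).symm φ, fun j => ?_⟩
  rw [← hφ j]
  conv_rhs => rw [← (Module.evalEquiv ℂ H).apply_symm_apply φ]
  rfl

lemma IsSimpleSystem.isPositiveRoot (hS : IsSimpleSystem H S) (j : ι) :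
    IsPositiveRoot H S (S j) := by
  classical
  exact ⟨hS.isRoot j, Pi.single j 1, by simp [Pi.single_apply]⟩

lemma IsPositiveRoot.add {β β' : Module.Dual ℂ H} (h : IsPositiveRoot H S β)
    (h' : IsPositiveRoot H S β') (hadd : IsRoot H (β + β')) : IsPositiveRoot H S (β + β') := by
  obtain ⟨n, hn⟩ := h.2
  obtain ⟨m, hm⟩ := h'.2
  refine ⟨hadd, n + m, ?_⟩
  rw [hn, hm, ← Finset.sum_add_distrib]
  simp [add_smul]

lemma apply_eq_sum {β : Module.Dual ℂ H} {n : ι → ℕ} (hn : β = ∑ j, n j • S j) (h : H) :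
    β h = ∑ j, n j * S j h := by
  rw [hn, LinearMap.sum_apply]
  simp

variable {t : H}

lemma IsPositiveRoot.exists_height {β : Module.Dual ℂ H} (h : IsPositiveRoot H S β)
    (ht : ∀ j, S j t = 1) : ∃ n : ℕ, 0 < n ∧ β t = n := by
  obtain ⟨n, hn⟩ := h.2
  refine ⟨∑ j, n j, ?_, by rw [apply_eq_sum hn]; simp [ht]⟩
  by_contra! h0
  have h0' : ∀ j, n j = 0 := fun j => by
    have := Finset.single_le_sum (f := n) (fun _ _ => Nat.zero_le _) (Finset.mem_univ j)
    omega
  exact h.1.1 (by simpa [h0'] using hn)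

lemma IsSimpleSystem.isPositiveRoot_or_neg [HasCentralRadical ℂ L] (hS : IsSimpleSystem H S)
    {β : Module.Dual ℂ H} (h : IsRoot H β) :
    IsPositiveRoot H S β ∨ IsPositiveRoot H S (-β) := by
  obtain ⟨n, hn | hn⟩ := hS.root_eq β h
  · exact Or.inl ⟨h, n, hn⟩
  · exact Or.inr ⟨h.neg, n, by rw [hn, neg_neg]⟩

lemma IsPositiveRoot.exists_coeff {β : Module.Dual ℂ H} (h : IsPositiveRoot H S β) {d : H}
    {δ : ι} [DecidableEq ι] (hd : ∀ j, S j d = if j = δ then 1 else 0) : ∃ n : ℕ, β d = n := by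
  obtain ⟨n, hn⟩ := h.2
  exact ⟨n δ, by rw [apply_eq_sum hn]; simp [hd]⟩

variable [HasCentralRadical ℂ L]

/-- If no β - S j is a root, the lowering vector f of β kills every simple root vector, so each S j
is nonpositive on the coroot of β. Then so is β, whereas its value there is 2. -/
lemma IsPositiveRoot.exists_sub_simple (hS : IsSimpleSystem H S) {β : Module.Dual ℂ H}
    (h : IsPositiveRoot H S β) (hsimple : ∀ j, β ≠ S j) : ∃ j, IsPositiveRoot H S (β - S j) := by
  obtain ⟨t, ht⟩ := hS.exists_apply_eq fun _ => 1
  suffices ∃ j, IsRoot H (β - S j) by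
    obtain ⟨j, hj⟩ := this
    refine ⟨j, (hS.isPositiveRoot_or_neg hj).resolve_right fun hneg => ?_⟩
    obtain ⟨n, hn, hn'⟩ := h.exists_height ht
    obtain ⟨m, hm, hm'⟩ := hneg.exists_height ht
    rw [LinearMap.neg_apply, LinearMap.sub_apply, hn', ht, neg_sub, sub_eq_iff_eq_add] at hm'
    have : 1 = m + n := by exact_mod_cast hm'
    omega
  by_contra! hcon
  obtain ⟨x, hx, hx0⟩ := exists_mem_of_isRoot h.1
  obtain ⟨h', f, hf, hsl, hh, -⟩ := exists_sl2 h.1.1 hx hx0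
  have key : ∀ j, ∃ m : ℕ, -(S j h') = m := by
    intro j
    obtain ⟨y, hy, hy0⟩ := exists_mem_of_isRoot (hS.isRoot j)
    refine exists_nat_of_lie_eq_zero hsl.symm hy0 (m := y) ?_ ?_
    · rw [neg_lie, lie_eq_smul (hS.isRoot j).1 hy, neg_smul]
    · have hne : β - S j ≠ 0 := sub_ne_zero.2 (hsimple j)
      refine eq_zero_of_not_isRoot (β := -(β - S j)) (neg_ne_zero.2 hne)
        (fun hr => hcon j (by simpa using hr.neg)) ?_
      exact rootSpace_congr (by abel) (lie_mem_rootSpace hf hy)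
  choose m hm using key
  obtain ⟨n, hn⟩ := h.2
  have h2 : ((2 + ∑ j, n j * m j : ℕ) : ℂ) = 0 := by
    push_cast
    rw [← hh, apply_eq_sum hn, ← Finset.sum_add_distrib]
    refine Finset.sum_eq_zero fun j _ => ?_
    rw [← hm]
    ring
  have : 2 + ∑ j, n j * m j = 0 := by exact_mod_cast h2
  omega

/-- The difference of the two simple roots has height 0, so it is not a root, and the lowering
vector of δ kills the root vector of α. By orthogonality that vector has weight 0 for the sl₂ of δ,
so the raising vector kills it too. -/
lemma IsSimpleSystem.not_isRoot_add (hS : IsSimpleSystem H S) {α δ : ι}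
    (h : IsOrthogonal H (S α) (S δ)) : ¬ IsRoot H (S α + S δ) := by
  intro hr
  obtain ⟨t, ht⟩ := hS.exists_apply_eq fun _ => 1
  obtain ⟨x, hx, hx0⟩ := exists_mem_of_isRoot (hS.isRoot α)
  obtain ⟨y, hy, hy0⟩ := exists_mem_of_isRoot (hS.isRoot δ)
  obtain ⟨h', f, hf, hsl, hh, -⟩ := exists_sl2 (hS.isRoot δ).1 hy hy0
  have hα : S α h' = 0 := h h' <| (mem_corootSpace _).2 <|
    Submodule.subset_span ⟨y, hy, f, hf, hsl.lie_e_f⟩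
  have hne : S α - S δ ≠ 0 := fun h0 => by
    rw [sub_eq_zero.1 h0, hh] at hα
    exact two_ne_zero hα
  have hnr : ¬ IsRoot H (S α - S δ) := by
    intro h0
    rcases hS.isPositiveRoot_or_neg h0 with h1 | h1 <;> obtain ⟨n, hn, hn'⟩ := h1.exists_height ht
    all_goals
      simp only [LinearMap.neg_apply, LinearMap.sub_apply, ht, sub_self, neg_zero] at hn'
      have : n = 0 := by exact_mod_cast hn'.symm
      omega
  have hfx : ⁅f, x⁆ = 0 := eq_zero_of_not_isRoot hne hnr
    (rootSpace_congr (by abel) (lie_mem_rootSpace hf hx))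
  have hyx : ⁅y, x⁆ = 0 := by
    refine lie_eq_zero_of_weight_zero hsl.symm ?_ hfx
    rw [neg_lie, lie_eq_smul (hS.isRoot α).1 hx, hα, zero_smul, neg_zero]
  exact lie_ne_zero (hS.isRoot δ).1 (hS.isRoot α).1 (by rwa [add_comm]) hy hy0 hx hx0 hyx

end SimpleSystem

/-! ### Splitting positive roots, and relations for u modulo the orbit tangent space -/

section Tangent

variable {L : Type*} [LieRing L] [LieAlgebra ℂ L] [FiniteDimensional ℂ L]
  {H : LieSubalgebra ℂ L} [H.IsCartanSubalgebra] [HasCentralRadical ℂ L]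
  {ι : Type*} [Fintype ι] {S : ι → Module.Dual ℂ H}

lemma IsPositiveRoot.add_ne_zero (hS : IsSimpleSystem H S) {β β' : Module.Dual ℂ H}
    (h : IsPositiveRoot H S β) (h' : IsPositiveRoot H S β') : β + β' ≠ 0 := by
  obtain ⟨t, ht⟩ := hS.exists_apply_eq fun _ => 1
  obtain ⟨n, hn, hn'⟩ := h.exists_height ht
  obtain ⟨m, hm, hm'⟩ := h'.exists_height ht
  intro h0
  have := LinearMap.congr_fun h0 t
  rw [LinearMap.add_apply, hn', hm', LinearMap.zero_apply] at this
  have : n + m = 0 := by exact_mod_cast this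
  omega

/-- A positive root `β ≠ δ` whose support contains `δ` is a sum of two positive roots `ε + η` such
that `δ` is in the support of `ε` and `η` is not a prescribed simple root orthogonal to `δ`. -/
lemma IsPositiveRoot.exists_eq_add [DecidableEq ι] (hS : IsSimpleSystem H S) {α δ : ι}
    (hαδ : IsOrthogonal H (S α) (S δ)) {d : H} (hd : ∀ j, S j d = if j = δ then 1 else 0)
    {β : Module.Dual ℂ H} (h : IsPositiveRoot H S β) (hβd : β d ≠ 0) (hβδ : β ≠ S δ) :
    ∃ ε η, IsPositiveRoot H S ε ∧ IsPositiveRoot H S η ∧ β = ε + η ∧ ε d ≠ 0 ∧ η ≠ S α := by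
  obtain ⟨t, ht⟩ := hS.exists_apply_eq fun _ => 1
  obtain ⟨n, -, hn⟩ := h.exists_height ht
  induction n using Nat.strong_induction_on generalizing β with
  | _ n ih =>
  have hδd : S δ d ≠ 0 := by simp [hd]
  obtain ⟨j, hj⟩ := h.exists_sub_simple hS fun j hj => by
    by_cases hjδ : j = δ
    · exact hβδ (hjδ ▸ hj)
    · rw [hj, hd, if_neg hjδ] at hβd
      exact hβd rfl
  have hβj : β = (β - S j) + S j := (sub_add_cancel _ _).symm
  by_cases hjδ : j = δ
  · subst hjδ
    refine ⟨S j, β - S j, hS.isPositiveRoot j, hj, (add_sub_cancel _ _).symm, hδd, fun h0 => ?_⟩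
    exact hS.not_isRoot_add hαδ (by rw [← h0, sub_add_cancel]; exact h.1)
  have hζd : (β - S j) d ≠ 0 := by rwa [LinearMap.sub_apply, hd, if_neg hjδ, sub_zero]
  by_cases hjα : j = α
  swap
  · exact ⟨_, _, hj, hS.isPositiveRoot j, hβj, hζd,
      fun h0 => hjα (hS.linearIndependent.injective h0)⟩
  -- Only the removal of α itself is left: split β - α by induction, then attach α to one of the two
  -- summands.
  subst hjα
  obtain ⟨m, -, hm⟩ := hj.exists_height ht
  have hmn : m < n := by
    rw [LinearMap.sub_apply, hn, ht, sub_eq_iff_eq_add] at hm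
    have : n = m + 1 := by exact_mod_cast hm
    omega
  have hζδ : β - S j ≠ S δ := fun h0 => by
    refine hS.not_isRoot_add hαδ ?_
    rw [← h0, add_sub_cancel]
    exact h.1
  obtain ⟨ε, η, hε, hη, hsum, hεd, hηα⟩ := ih m hmn hj hζd hζδ hm
  have hα := hS.isPositiveRoot j
  have hβ : β = S j + (ε + η) := by rw [← hsum, add_sub_cancel]
  by_cases h1 : IsRoot H (S j + ε)
  · refine ⟨S j + ε, η, hα.add hε h1, hη, by rw [hβ, add_assoc], ?_, hηα⟩
    rwa [LinearMap.add_apply, hd, if_neg hjδ, zero_add]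
  by_cases h2 : IsRoot H (S j + η)
  · exact ⟨ε, S j + η, hε, hα.add hη h2, by rw [hβ]; abel, hεd, by simpa using hη.1.1⟩
  -- If α can be attached to neither summand, e_α commutes with e_ε and e_η, hence with their
  -- bracket, a nonzero vector of weight β - α; yet β is a root.
  exfalso
  have h3 : ⁅eVec (S j), eVec ε⁆ = 0 := eq_zero_of_not_isRoot (hα.add_ne_zero hS hε) h1
    (lie_mem_rootSpace (eVec_mem hα.1) (eVec_mem hε.1))
  have h4 : ⁅eVec (S j), eVec η⁆ = 0 := eq_zero_of_not_isRoot (hα.add_ne_zero hS hη) h2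
    (lie_mem_rootSpace (eVec_mem hα.1) (eVec_mem hη.1))
  have hr : IsRoot H (ε + η) := hsum ▸ hj.1
  refine lie_ne_zero hα.1.1 hr.1 (hβ ▸ h.1) (eVec_mem hα.1) (eVec_ne_zero hα.1)
    (lie_mem_rootSpace (eVec_mem hε.1) (eVec_mem hη.1))
    (lie_ne_zero hε.1.1 hη.1.1 hr (eVec_mem hε.1) (eVec_ne_zero hε.1)
      (eVec_mem hη.1) (eVec_ne_zero hη.1)) ?_
  rw [leibniz_lie, h3, h4, zero_lie, lie_zero, add_zero]

variable {M : Type*} [AddCommGroup M] [Module ℂ M] [LieRingModule L M] [LieModule ℂ L M]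

/-- `v` behaves like a sum of highest weight vectors, and `u` is a vector of weight `-γ` relative to
`v` that is mapped to the tangent space `L.v` by all positive root vectors except those of the
simple root `α`. -/
structure IsTangentPair (S : ι → Module.Dual ℂ H) (α : ι) (γ : Module.Dual ℂ H) (v u : M) :
    Prop where
  lie_eq_zero : ∀ β, IsPositiveRoot H S β → ∀ x ∈ rootSpace H β, ⁅x, v⁆ = 0
  fVec_lie : ∀ β, IsPositiveRoot H S β → ⁅tVec β, v⁆ = 0 → ⁅fVec β, v⁆ = 0
  tVec_lie : ∀ β β', IsPositiveRoot H S β → IsPositiveRoot H S β' →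
    ⁅tVec β, v⁆ + ⁅tVec β', v⁆ = 0 → ⁅tVec β, v⁆ = 0
  exists_lie_eq : ∀ β, IsPositiveRoot H S β → β ≠ S α →
    ∃ y ∈ rootSpace H (β - γ : Module.Dual ℂ H), ⁅eVec β, u⁆ = ⁅y, v⁆

namespace IsTangentPair

variable {α δ : ι} {γ : Module.Dual ℂ H} {v u : M}

lemma eVec_lie (hT : IsTangentPair S α γ v u) {β : Module.Dual ℂ H} (hβ : IsPositiveRoot H S β) :
    ⁅eVec β, v⁆ = 0 :=
  hT.lie_eq_zero β hβ _ (eVec_mem hβ.1)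

lemma eVec_lie_fVec_lie (hT : IsTangentPair S α γ v u) {β : Module.Dual ℂ H}
    (hβ : IsPositiveRoot H S β) : ⁅eVec β, ⁅fVec β, v⁆⁆ = ⁅tVec β, v⁆ := by
  rw [leibniz_lie, hT.eVec_lie hβ, lie_zero, add_zero, tVec]

lemma exists_eVec_lie_eq_smul (hT : IsTangentPair S α γ v u) {β β' : Module.Dual ℂ H}
    (hβ : IsPositiveRoot H S β) (hβα : β ≠ S α) (hβ' : IsPositiveRoot H S β')
    (hγ : γ = β + β') : ∃ c : ℂ, ⁅eVec β, u⁆ = c • ⁅fVec β', v⁆ := by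
  obtain ⟨y, hy, hyv⟩ := hT.exists_lie_eq β hβ hβα
  obtain ⟨c, rfl⟩ := eq_smul_fVec hβ'.1 (rootSpace_congr (by rw [hγ]; abel) hy)
  exact ⟨c, by rw [hyv, smul_lie]⟩

/-- Here e_β u = y.v with y of weight β - γ, and this weight is either not a root or a positive
root, whose root vectors kill v. -/
lemma eVec_lie_eq_zero (hS : IsSimpleSystem H S) (hT : IsTangentPair S α γ v u)
    {β : Module.Dual ℂ H} (hβ : IsPositiveRoot H S β) (hβα : β ≠ S α)
    (hβ' : ¬ IsPositiveRoot H S (γ - β)) (hγβ : γ ≠ β) : ⁅eVec β, u⁆ = 0 := by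
  obtain ⟨y, hy, hyv⟩ := hT.exists_lie_eq β hβ hβα
  rw [hyv]
  by_cases hr : IsRoot H (β - γ)
  · refine hT.lie_eq_zero _ ((hS.isPositiveRoot_or_neg hr).resolve_right ?_) y hy
    rwa [neg_sub]
  · rw [eq_zero_of_not_isRoot (sub_ne_zero.2 hγβ.symm) hr hy, zero_lie]

/-- The commutation relations of `u` along a decomposition `γ = ε + η + β'`. -/
lemma exists_of_eq_add (hT : IsTangentPair S α γ v u) {ε η β' : Module.Dual ℂ H}
    (hε : IsPositiveRoot H S ε) (hη : IsPositiveRoot H S η) (hβ' : IsPositiveRoot H S β')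
    (hβ : IsRoot H (ε + η)) (hη' : IsRoot H (ε + β')) (hγ : γ = ε + η + β') (hηα : η ≠ S α)
    (hβ'α : β' ≠ S α) (hεu : ⁅eVec ε, u⁆ = 0)
    (hcomm : ⁅eVec ε, ⁅⁅eVec β', eVec η⁆, u⁆⁆ = 0) (hεv : ⁅tVec ε, v⁆ ≠ 0) :
    ∃ p : ℂ, ⁅eVec (ε + η), u⁆ = -p • ⁅fVec β', v⁆ ∧
      ⁅eVec β', u⁆ = p • ⁅fVec (ε + η), v⁆ := by
  obtain ⟨c, hc⟩ := hT.exists_eVec_lie_eq_smul hη hηα (hε.add hβ' hη') (by rw [hγ]; abel)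
  obtain ⟨c', hc'⟩ := hT.exists_eVec_lie_eq_smul hβ' hβ'α (hε.add hη hβ) (by rw [hγ]; abel)
  obtain ⟨N, hN, h1, h2, -, h3⟩ := lie_eVec_fVec_add hε.1 hη.1 hβ
  obtain ⟨N', hN', h1', h2', -, h3'⟩ := lie_eVec_fVec_add hε.1 hβ'.1 hη'
  have e1 : ⁅eVec ε, ⁅eVec η, u⁆⁆ = -(c * N') • ⁅fVec β', v⁆ := by
    rw [hc, lie_smul, leibniz_lie, hT.eVec_lie hε, lie_zero, add_zero, h2', smul_lie, smul_smul]
    congr 1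
    ring
  have e2 : N • ⁅eVec (ε + η), u⁆ = -(c * N') • ⁅fVec β', v⁆ := by
    rw [← smul_lie, ← h1, lie_lie, hεu, lie_zero, sub_zero, e1]
  have e3 : ⁅eVec ε, ⁅eVec β', u⁆⁆ = -(c' * N) • ⁅fVec η, v⁆ := by
    rw [hc', lie_smul, leibniz_lie, hT.eVec_lie hε, lie_zero, add_zero, h2, smul_lie, smul_smul]
    congr 1
    ring
  have e4 : N' • ⁅eVec (ε + β'), u⁆ = -(c' * N) • ⁅fVec η, v⁆ := by
    rw [← smul_lie, ← h1', lie_lie, hεu, lie_zero, sub_zero, e3]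
  -- The vector [e_{ε+β'}, e_η]u is expanded directly here, and in `e6` by writing e_{ε+β'} through
  -- [e_ε, e_β']. By additivity of t the two results differ by a multiple of t_ε v, which is
  -- nonzero, so N'c = c'N.
  have e5 : N' • ⁅⁅eVec (ε + β'), eVec η⁆, u⁆ =
      (N' * c) • ⁅tVec (ε + β'), v⁆ + (c' * N) • ⁅tVec η, v⁆ := by
    rw [lie_lie, smul_sub, ← lie_smul N' (eVec η), e4, hc, lie_smul, smul_smul, lie_smul,
      hT.eVec_lie_fVec_lie (hε.add hβ' hη'), hT.eVec_lie_fVec_lie hη, neg_smul, sub_neg_eq_add]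
  have e6 : N' • ⁅⁅eVec (ε + β'), eVec η⁆, u⁆ =
      (c' * N) • ⁅tVec (ε + η), v⁆ + (c * N') • ⁅tVec β', v⁆ := by
    have f1 : ⁅eVec ε, ⁅eVec β', ⁅eVec η, u⁆⁆⁆ = ⁅eVec ε, ⁅eVec η, ⁅eVec β', u⁆⁆⁆ := by
      rw [lie_lie, lie_sub, sub_eq_zero] at hcomm
      exact hcomm
    have f2 : ⁅eVec ε, ⁅eVec η, ⁅eVec β', u⁆⁆⁆ - ⁅eVec η, ⁅eVec ε, ⁅eVec β', u⁆⁆⁆ =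
        (c' * N) • ⁅tVec (ε + η), v⁆ := by
      rw [← lie_lie, h1, smul_lie, hc', lie_smul, hT.eVec_lie_fVec_lie (hε.add hη hβ), smul_smul,
        mul_comm]
    have f3 : ⁅eVec β', ⁅eVec ε, ⁅eVec η, u⁆⁆⁆ = -(c * N') • ⁅tVec β', v⁆ := by
      rw [e1, lie_smul, hT.eVec_lie_fVec_lie hβ']
    rw [← smul_lie, ← smul_lie, ← h1', lie_lie, lie_lie, lie_lie, hεu, lie_zero, sub_zero, f1, f3,
      ← f2, neg_smul]
    abel
  have e7 : N' * c = c' * N := by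
    rw [e5, h3, h3', add_lie, add_lie, smul_add, smul_add, mul_comm c N'] at e6
    have e8 : (N' * c - c' * N) • ⁅tVec ε, v⁆ = 0 := by
      rw [sub_smul, sub_eq_zero]
      have := sub_eq_zero.2 e6
      rw [← sub_eq_zero, ← this]
      abel
    exact sub_eq_zero.1 ((smul_eq_zero.1 e8).resolve_right hεv)
  refine ⟨c', ?_, hc'⟩
  refine smul_right_injective M hN ?_
  change N • _ = N • _
  rw [e2, mul_comm, e7, smul_smul]
  congr 1
  ring

end IsTangentPair

end Tangent

/-! ### Vanishing of u under the nilradical attached to δ -/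

section Tangent

variable {L : Type*} [LieRing L] [LieAlgebra ℂ L] [FiniteDimensional ℂ L]
  {H : LieSubalgebra ℂ L} [H.IsCartanSubalgebra] [HasCentralRadical ℂ L]
  {ι : Type*} [Fintype ι] {S : ι → Module.Dual ℂ H} [DecidableEq ι]
  {M : Type*} [AddCommGroup M] [Module ℂ M] [LieRingModule L M] [LieModule ℂ L M]
  {α δ : ι} {γ : Module.Dual ℂ H} {v u : M} {d : H}

lemma IsSimpleSystem.ne_of_isOrthogonal (hS : IsSimpleSystem H S)
    (h : IsOrthogonal H (S α) (S δ)) : α ≠ δ := by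
  rintro rfl
  obtain ⟨y, hy, hy0⟩ := exists_mem_of_isRoot (hS.isRoot α)
  obtain ⟨h', f, hf, hsl, hh, -⟩ := exists_sl2 (hS.isRoot α).1 hy hy0
  have hα : S α h' = 0 := h h' <| (mem_corootSpace _).2 <|
    Submodule.subset_span ⟨y, hy, f, hf, hsl.lie_e_f⟩
  rw [hh] at hα
  exact two_ne_zero hα

lemma IsPositiveRoot.add_ne_simple (hS : IsSimpleSystem H S) {β β' : Module.Dual ℂ H}
    (h : IsPositiveRoot H S β) (h' : IsPositiveRoot H S β') (j : ι) : β + β' ≠ S j := by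
  obtain ⟨t, ht⟩ := hS.exists_apply_eq fun _ => 1
  obtain ⟨n, hn, hn'⟩ := h.exists_height ht
  obtain ⟨m, hm, hm'⟩ := h'.exists_height ht
  intro h0
  have := LinearMap.congr_fun h0 t
  rw [LinearMap.add_apply, hn', hm', ht] at this
  have : n + m = 1 := by exact_mod_cast this
  omega

lemma IsPositiveRoot.height_lt {β β' : Module.Dual ℂ H} {t : H}
    (ht : ∀ j, S j t = 1) (h' : IsPositiveRoot H S β')
    {n m : ℕ} (hn : (β + β') t = n) (hm : β t = m) : m < n := by
  obtain ⟨k, hk, hk'⟩ := h'.exists_height ht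
  rw [LinearMap.add_apply, hm, hk'] at hn
  have : m + k = n := by exact_mod_cast hn
  omega

namespace IsTangentPair

/-- Split β = ε + η: applying e_η to f_β v gives a nonzero multiple of f_ε v. Descending in height
reaches f_δ v, which e_δ sends to t_δ v ≠ 0. -/
lemma fVec_lie_ne_zero (hT : IsTangentPair S α γ v u) (hS : IsSimpleSystem H S)
    (hαδ : IsOrthogonal H (S α) (S δ)) (hd : ∀ j, S j d = if j = δ then 1 else 0)
    (hδv : ⁅tVec (S δ), v⁆ ≠ 0) {β : Module.Dual ℂ H} (h : IsPositiveRoot H S β)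
    (hβd : β d ≠ 0) : ⁅fVec β, v⁆ ≠ 0 := by
  obtain ⟨t, ht⟩ := hS.exists_apply_eq fun _ => 1
  obtain ⟨n, -, hn⟩ := h.exists_height ht
  induction n using Nat.strong_induction_on generalizing β with
  | _ n ih =>
  intro h0
  by_cases hβδ : β = S δ
  · subst hβδ
    refine hδv ?_
    rw [← hT.eVec_lie_fVec_lie h, h0, lie_zero]
  obtain ⟨ε, η, hε, hη, rfl, hεd, -⟩ := h.exists_eq_add hS hαδ hd hβd hβδ
  obtain ⟨m, -, hm⟩ := hε.exists_height ht
  refine ih m (hη.height_lt ht hn hm) hε hεd hm ?_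
  obtain ⟨N, hN, -, -, h1, -⟩ := lie_eVec_fVec_add hε.1 hη.1 h.1
  have h2 := lie_lie (eVec η) (fVec (ε + η)) v
  rw [h1, h0, hT.eVec_lie hη, lie_zero, lie_zero, sub_zero, smul_lie] at h2
  exact (smul_eq_zero.1 h2).resolve_left hN

lemma tVec_lie_ne_zero (hT : IsTangentPair S α γ v u) (hS : IsSimpleSystem H S)
    (hαδ : IsOrthogonal H (S α) (S δ)) (hd : ∀ j, S j d = if j = δ then 1 else 0)
    (hδv : ⁅tVec (S δ), v⁆ ≠ 0) {β : Module.Dual ℂ H} (h : IsPositiveRoot H S β)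
    (hβd : β d ≠ 0) : ⁅tVec β, v⁆ ≠ 0 :=
  fun h0 => hT.fVec_lie_ne_zero hS hαδ hd hδv h hβd (hT.fVec_lie β h h0)

/-- If `γ` is a root, then `u` can be modified by a multiple of `fVec γ • v` so that it is killed by
`eVec γ`. -/
lemma exists_eVec_lie_eq_smul_tVec_lie (hT : IsTangentPair S α γ v u) (hS : IsSimpleSystem H S)
    (hαδ : IsOrthogonal H (S α) (S δ)) (hd : ∀ j, S j d = if j = δ then 1 else 0)
    (hδv : ⁅tVec (S δ), v⁆ ≠ 0) (hγ : IsPositiveRoot H S γ) (hγd : γ d ≠ 0)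
    (hγδ_ne : γ ≠ S δ) (hγδ : ¬ IsRoot H (γ - S δ)) :
    ∃ c : ℂ, ⁅eVec γ, u⁆ = c • ⁅tVec γ, v⁆ := by
  obtain ⟨t, ht⟩ := hS.exists_apply_eq fun _ => 1
  have hαd : S α d = 0 := by rw [hd, if_neg (hS.ne_of_isOrthogonal hαδ)]
  -- Descent from β = γ through roots β for which γ - β is still zero or a positive root. It must
  -- stop before δ, since γ ≠ δ and γ - δ is not a root.
  suffices ∀ (n : ℕ) (β : Module.Dual ℂ H), IsPositiveRoot H S β → β d ≠ 0 →
      (γ = β ∨ IsPositiveRoot H S (γ - β)) → γ - β ≠ S α → β t = n →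
      ∃ c : ℂ, ⁅eVec γ, u⁆ = c • ⁅tVec γ, v⁆ by
    obtain ⟨n, -, hn⟩ := hγ.exists_height ht
    exact this n γ hγ hγd (Or.inl rfl) (by rw [sub_self]; exact (hS.isRoot α).1.symm) hn
  intro n
  induction n using Nat.strong_induction_on with
  | _ n ih =>
  intro β hβ hβd hγβ hβα hn
  have hβδ : β ≠ S δ := by
    rintro rfl
    exact hγβ.elim hγδ_ne fun h => hγδ h.1
  obtain ⟨ε, η, hε, hη, rfl, hεd, hηα⟩ := hβ.exists_eq_add hS hαδ hd hβd hβδ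
  have hεα : ε ≠ S α := fun h0 => hεd (by rw [h0, hαd])
  obtain ⟨m, -, hm⟩ := hε.exists_height ht
  have hmn := hη.height_lt ht hn hm
  by_cases hQ : (γ = ε ∨ IsPositiveRoot H S (γ - ε)) ∧ γ - ε ≠ S α
  · exact ih m hmn ε hε hεd hQ.1 hQ.2 hm
  obtain ⟨β', hβ'⟩ : ∃ β', β' = γ - (ε + η) := ⟨_, rfl⟩
  have hγsum : γ = ε + η + β' := by rw [hβ']; abel
  have hγε : γ - ε = β' + η := by rw [hβ']; abel
  have hβ'pos : IsPositiveRoot H S β' := by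
    refine hβ' ▸ hγβ.resolve_left fun h0 => hQ ?_
    have : γ - ε = η := by rw [h0]; abel
    rw [this]
    exact ⟨Or.inr hη, hηα⟩
  rw [hγε] at hQ
  have hγε_ne : γ ≠ ε := fun h0 => hβ'pos.add_ne_zero hS hη (by rw [← hγε, h0, sub_self])
  -- A sum of two positive roots is never simple, so the descent can only have stopped because γ - ε
  -- is not a positive root.
  have hnp : ¬ IsPositiveRoot H S (β' + η) :=
    fun h0 => hQ ⟨Or.inr h0, hβ'pos.add_ne_simple hS hη α⟩
  have hεu : ⁅eVec ε, u⁆ = 0 := hT.eVec_lie_eq_zero hS hε hεα (by rwa [hγε]) hγε_ne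
  have hcomm : ⁅eVec β', eVec η⁆ = 0 :=
    eq_zero_of_not_isRoot (hβ'pos.add_ne_zero hS hη) (fun h0 => hnp (hβ'pos.add hη h0))
      (lie_mem_rootSpace (eVec_mem hβ'pos.1) (eVec_mem hη.1))
  have hγr : IsRoot H (β' + (ε + η)) := by rw [add_comm, ← hγsum]; exact hγ.1
  obtain ⟨N, hN, h1, -, -, -⟩ := lie_eVec_fVec_add hε.1 hη.1 hβ.1
  obtain ⟨N', hN', h1', -, -, h3'⟩ := lie_eVec_fVec_add hβ'pos.1 hβ.1 hγr
  -- Since e_β' commutes with e_η, it must not commute with e_ε: otherwise it would commute with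
  -- e_{ε+η}, although γ = β' + (ε + η) is a root.
  have hη' : IsRoot H (ε + β') := by
    by_contra h0
    have h4 : ⁅eVec β', eVec ε⁆ = 0 :=
      eq_zero_of_not_isRoot (hβ'pos.add_ne_zero hS hε) (by rwa [add_comm])
        (lie_mem_rootSpace (eVec_mem hβ'pos.1) (eVec_mem hε.1))
    have h5 := leibniz_lie (eVec β') (eVec ε) (eVec η)
    rw [h4, hcomm, zero_lie, lie_zero, add_zero, h1, lie_smul, h1', smul_smul] at h5
    exact (smul_eq_zero.1 h5).elim (mul_ne_zero hN hN') (eVec_ne_zero hγr)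
  obtain ⟨p, hp, hp'⟩ := hT.exists_of_eq_add hε hη hβ'pos hβ.1 hη' hγsum hηα
    (by rwa [hβ']) hεu (by rw [hcomm, zero_lie, lie_zero])
    (hT.tVec_lie_ne_zero hS hαδ hd hδv hε hεd)
  have h6 : N' • ⁅eVec γ, u⁆ = -p • ⁅tVec γ, v⁆ := by
    rw [show γ = β' + (ε + η) by rw [hγsum]; abel, ← smul_lie, ← h1', lie_lie, hp, hp', lie_smul,
      lie_smul, hT.eVec_lie_fVec_lie hβ'pos, hT.eVec_lie_fVec_lie hβ, h3', add_lie, smul_add,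
      neg_smul, neg_smul]
    abel
  refine ⟨N'⁻¹ * -p, ?_⟩
  rw [mul_smul, ← h6, inv_smul_smul₀ hN']

/-- Lets every bracket of total weight γ be treated as killing u: either γ is not a root and the
bracket is zero, or it is a multiple of e_γ. -/
lemma lie_eq_zero_of_mem (hS : IsSimpleSystem H S) (hγu : IsPositiveRoot H S γ → ⁅eVec γ, u⁆ = 0)
    {β β' : Module.Dual ℂ H} (hβ : IsPositiveRoot H S β) (hβ' : IsPositiveRoot H S β')
    (hγ : γ = β + β') {x : L} (hx : x ∈ rootSpace H γ) : ⁅x, u⁆ = 0 := by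
  by_cases hr : IsRoot H γ
  · obtain ⟨c, rfl⟩ := eq_smul_eVec hr hx
    rw [smul_lie, hγu (hγ ▸ hβ.add hβ' (hγ ▸ hr)), smul_zero]
  · rw [eq_zero_of_not_isRoot (hγ ▸ hβ.add_ne_zero hS hβ') hr hx, zero_lie]

lemma eVec_lie_eq_zero_of_sub_ne (hT : IsTangentPair S α γ v u) (hS : IsSimpleSystem H S)
    (hαδ : IsOrthogonal H (S α) (S δ)) (hd : ∀ j, S j d = if j = δ then 1 else 0)
    (hδv : ⁅tVec (S δ), v⁆ ≠ 0) (hγδ_ne : γ ≠ S δ) (hγδ : ¬ IsRoot H (γ - S δ))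
    (hγu : IsPositiveRoot H S γ → ⁅eVec γ, u⁆ = 0) {β : Module.Dual ℂ H}
    (hβ : IsPositiveRoot H S β) (hβd : β d ≠ 0) (hβα : γ - β ≠ S α) : ⁅eVec β, u⁆ = 0 := by
  obtain ⟨t, ht⟩ := hS.exists_apply_eq fun _ => 1
  have hαd : S α d = 0 := by rw [hd, if_neg (hS.ne_of_isOrthogonal hαδ)]
  obtain ⟨n, -, hn⟩ := hβ.exists_height ht
  induction n using Nat.strong_induction_on generalizing β with
  | _ n ih =>
  have hne : ∀ {ε : Module.Dual ℂ H}, ε d ≠ 0 → ε ≠ S α := fun hεd h0 => hεd (by rw [h0, hαd])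
  by_cases hβδ : β = S δ
  · subst hβδ
    exact hT.eVec_lie_eq_zero hS hβ (hne hβd) (fun h => hγδ h.1) hγδ_ne
  by_cases hγβ : γ = β
  · subst hγβ
    exact hγu hβ
  obtain ⟨β', hβ'⟩ : ∃ β', β' = γ - β := ⟨_, rfl⟩
  by_cases hβ'pos : IsPositiveRoot H S β'
  swap
  · exact hT.eVec_lie_eq_zero hS hβ (hne hβd) (hβ' ▸ hβ'pos) hγβ
  obtain ⟨ε, η, hε, hη, rfl, hεd, hηα⟩ := hβ.exists_eq_add hS hαδ hd hβd hβδ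
  have hγsum : γ = ε + η + β' := by rw [hβ']; abel
  obtain ⟨m, -, hm⟩ := hε.exists_height ht
  have hεu : ⁅eVec ε, u⁆ = 0 := by
    refine ih m (hη.height_lt ht hn hm) hε hεd (fun h0 => ?_) hm
    refine hη.add_ne_simple hS hβ'pos α ?_
    rw [← h0, hγsum]
    abel
  by_contra hβu
  obtain ⟨N, hN, h1, -, -, -⟩ := lie_eVec_fVec_add hε.1 hη.1 hβ.1
  -- If γ - η = ε + β' is not a positive root, e_η kills u; as e_ε does too, so does e_β.
  have hη'pos : IsPositiveRoot H S (ε + β') := by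
    by_contra h0
    have hηu : ⁅eVec η, u⁆ = 0 := by
      refine hT.eVec_lie_eq_zero hS hη hηα (fun h2 => h0 ?_) fun h2 => ?_
      · rwa [show ε + β' = γ - η by rw [hγsum]; abel]
      · refine hε.add_ne_zero hS hβ'pos ?_
        rw [show ε + β' = γ - η by rw [hγsum]; abel, h2, sub_self]
    refine hβu ((smul_eq_zero.1 ?_).resolve_left hN)
    rw [← smul_lie, ← h1, lie_lie, hεu, hηu, lie_zero, lie_zero, sub_zero]
  have hkill : ∀ {a b : Module.Dual ℂ H}, IsPositiveRoot H S a → IsPositiveRoot H S b →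
      γ = a + b → ⁅⁅eVec a, eVec b⁆, u⁆ = 0 := fun ha hb hab =>
    lie_eq_zero_of_mem hS hγu ha hb hab
      (rootSpace_congr hab.symm (lie_mem_rootSpace (eVec_mem ha.1) (eVec_mem hb.1)))
  have hcomm : ⁅eVec ε, ⁅⁅eVec β', eVec η⁆, u⁆⁆ = 0 := by
    have h2 : ⁅⁅eVec ε, ⁅eVec β', eVec η⁆⁆, u⁆ = 0 := by
      refine lie_eq_zero_of_mem hS hγu hη hη'pos (by rw [hγsum]; abel)
        (rootSpace_congr ?_ (lie_mem_rootSpace (eVec_mem hε.1)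
          (lie_mem_rootSpace (eVec_mem hβ'pos.1) (eVec_mem hη.1))))
      rw [hγsum]
      abel
    rw [lie_lie, hεu, lie_zero, sub_zero] at h2
    exact h2
  obtain ⟨p, hp, hp'⟩ := hT.exists_of_eq_add hε hη hβ'pos hβ.1 hη'pos.1 hγsum hηα
    (by rwa [hβ']) hεu hcomm (hT.tVec_lie_ne_zero hS hαδ hd hδv hε hεd)
  have h6 : p • (⁅tVec (ε + η), v⁆ + ⁅tVec β', v⁆) = 0 := by
    have := hkill hβ hβ'pos hγsum
    rw [lie_lie, hp, hp', lie_smul, lie_smul, hT.eVec_lie_fVec_lie hβ'pos,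
      hT.eVec_lie_fVec_lie hβ, neg_smul, sub_neg_eq_add, ← smul_add] at this
    exact this
  -- Either p = 0, so e_β u = 0, or (t_β + t_β')v = 0, so t_β v = 0 by positivity, against δ being
  -- in the support of β.
  rcases smul_eq_zero.1 h6 with rfl | h7
  · exact hβu (by rw [hp, neg_zero, zero_smul])
  · exact hT.tVec_lie_ne_zero hS hαδ hd hδv hβ hβd (hT.tVec_lie _ _ hβ hβ'pos h7)

/-- Under the hypotheses of the main theorem, `u` is killed by the nilradical of the maximal
parabolic subalgebra defined by `δ`. -/
lemma eVec_lie_eq_zero_of_coeff_ne_zero (hT : IsTangentPair S α γ v u) (hS : IsSimpleSystem H S)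
    (hαδ : IsOrthogonal H (S α) (S δ)) (hd : ∀ j, S j d = if j = δ then 1 else 0)
    (hδv : ⁅tVec (S δ), v⁆ ≠ 0) (hγδ_ne : γ ≠ S δ) (hγδ : ¬ IsRoot H (γ - S δ))
    (hγu : IsPositiveRoot H S γ → ⁅eVec γ, u⁆ = 0) {β : Module.Dual ℂ H}
    (hβ : IsPositiveRoot H S β) (hβd : β d ≠ 0) : ⁅eVec β, u⁆ = 0 := by
  have hmain := fun {β : Module.Dual ℂ H} (hβ : IsPositiveRoot H S β) (hβd : β d ≠ 0)
    (hβα : γ - β ≠ S α) => hT.eVec_lie_eq_zero_of_sub_ne hS hαδ hd hδv hγδ_ne hγδ hγu hβ hβd hβα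
  by_cases hβα : γ - β = S α
  swap
  · exact hmain hβ hβd hβα
  have hαd : S α d = 0 := by rw [hd, if_neg (hS.ne_of_isOrthogonal hαδ)]
  have hβδ : β ≠ S δ := by
    rintro rfl
    exact hγδ (hβα ▸ hS.isRoot α)
  obtain ⟨ε, η, hε, hη, rfl, hεd, hηα⟩ := hβ.exists_eq_add hS hαδ hd hβd hβδ
  have hγsum : γ = ε + S α + η := by rw [← hβα]; abel
  have hεu : ⁅eVec ε, u⁆ = 0 := hmain hε hεd fun h0 =>
    hη.1.1 (by rw [hγsum, add_assoc, add_sub_cancel_left] at h0; simpa using h0)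
  -- If ε + α is a root, e_{ε+α} kills u and e_η u = c f_{ε+α} v. The bracket [e_{ε+α}, e_η] has
  -- weight γ and kills u, so c t_{ε+α} v = 0 and c = 0.
  have hηu : ⁅eVec η, u⁆ = 0 := by
    by_cases hη' : IsPositiveRoot H S (ε + S α)
    · have hη'd : (ε + S α) d ≠ 0 := by rwa [LinearMap.add_apply, hαd, add_zero]
      have hη'u : ⁅eVec (ε + S α), u⁆ = 0 := hmain hη' hη'd
        (by rwa [hγsum, add_sub_cancel_left])
      obtain ⟨c, hc⟩ := hT.exists_eVec_lie_eq_smul hη hηα hη' (by rw [hγsum]; abel)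
      have h2 := lie_eq_zero_of_mem hS hγu hη' hη hγsum
        (rootSpace_congr hγsum.symm (lie_mem_rootSpace (eVec_mem hη'.1) (eVec_mem hη.1)))
      rw [lie_lie, hη'u, lie_zero, sub_zero, hc, lie_smul, hT.eVec_lie_fVec_lie hη'] at h2
      rw [hc, (smul_eq_zero.1 h2).resolve_right (hT.tVec_lie_ne_zero hS hαδ hd hδv hη' hη'd),
        zero_smul]
    · refine hT.eVec_lie_eq_zero hS hη hηα (by rwa [hγsum, add_sub_cancel_right]) fun h0 => ?_
      refine hε.add_ne_zero hS (hS.isPositiveRoot α) ?_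
      rw [h0] at hγsum
      simpa using hγsum
  obtain ⟨N, hN, h1, -, -, -⟩ := lie_eVec_fVec_add hε.1 hη.1 hβ.1
  refine (smul_eq_zero.1 ?_).resolve_left hN
  rw [← smul_lie, ← h1, lie_lie, hεu, hηu, lie_zero, lie_zero, sub_zero]

end IsTangentPair

end Tangent

/-! ### Irreducible modules and highest weight vectors -/

section Modules

variable {L : Type*} [LieRing L] [LieAlgebra ℂ L] [FiniteDimensional ℂ L]
  {H : LieSubalgebra ℂ L} [H.IsCartanSubalgebra] [HasCentralRadical ℂ L]
  {ι : Type*} [Fintype ι] {S : ι → Module.Dual ℂ H}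

/-- In an irreducible module, a weight vector killed by the nilradical of the maximal parabolic
subalgebra defined by `δ` has the largest `d`-eigenvalue. -/
lemma exists_nat_of_isIrreducible {M : Type*} [AddCommGroup M] [Module ℂ M] [LieRingModule L M]
    [LieModule ℂ L M] [LieModule.IsIrreducible ℂ L M] [DecidableEq ι]
    (hS : IsSimpleSystem H S) {δ : ι} {d : H} (hd : ∀ j, S j d = if j = δ then 1 else 0)
    {m m' : M} {χ χ' : H → ℂ} (hm : m ∈ genWeightSpace M χ) (hm0 : m ≠ 0)
    (hkill : ∀ β, IsPositiveRoot H S β → β d ≠ 0 → ∀ x ∈ rootSpace H β, ⁅x, m⁆ = 0)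
    (hm' : m' ∈ genWeightSpace M χ') (hm'0 : m' ≠ 0) : ∃ j : ℕ, χ' d = χ d - j := by
  -- W is the smallest subspace containing m and stable under the opposite parabolic, where d has
  -- eigenvalues in -ℕ. Minimality replaces a Poincaré–Birkhoff–Witt argument.
  let P : Submodule ℂ M → Prop := fun N => m ∈ N ∧ ∀ β : Module.Dual ℂ H, (∃ j : ℕ, β d = -j) →
    ∀ x ∈ rootSpace H β, ∀ w ∈ N, ⁅x, w⁆ ∈ N
  let W : Submodule ℂ M := sInf {N | P N}
  have hle : ∀ N, P N → W ≤ N := fun N hN => sInf_le hN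
  have hW : P W := by
    refine ⟨(Submodule.mem_sInf).2 fun N hN => hN.1, fun β hβ x hx w hw => ?_⟩
    exact (Submodule.mem_sInf).2 fun N hN => hN.2 β hβ x hx w (hle N hN hw)
  -- The vectors of W that all of L keeps inside W. They again satisfy `P`, so minimality gives U =
  -- W: thus W is an L-submodule, hence everything.
  let U : Submodule ℂ M :=
    { carrier := {w | w ∈ W ∧ ∀ x : L, ⁅x, w⁆ ∈ W}
      add_mem' := fun {a b} ha hb =>
        ⟨W.add_mem ha.1 hb.1, fun x => by rw [lie_add]; exact W.add_mem (ha.2 x) (hb.2 x)⟩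
      zero_mem' := ⟨W.zero_mem, fun x => by rw [lie_zero]; exact W.zero_mem⟩
      smul_mem' := fun c a ha =>
        ⟨W.smul_mem c ha.1, fun x => by rw [lie_smul]; exact W.smul_mem c (ha.2 x)⟩ }
  have hU : P U := by
    refine ⟨⟨hW.1, fun x => ?_⟩, fun β hβ x hx w hw => ⟨hW.2 β hβ x hx w hw.1, fun y => ?_⟩⟩
    · have hx : x ∈ ⨆ χ, rootSpace H χ := by simp [iSup_genWeightSpace_eq_top ℂ H L]
      induction hx using LieSubmodule.iSup_induction' with
      | mem ψ x hx =>
        by_cases hx0 : x = 0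
        · simp [hx0]
        obtain ⟨β, rfl⟩ := exists_dual_eq_of_mem_genWeightSpace hx hx0
        by_cases hβ0 : β = 0
        · exact hW.2 β ⟨0, by simp [hβ0]⟩ x hx m hW.1
        rcases hS.isPositiveRoot_or_neg (isRoot_of_mem hβ0 hx hx0) with h | h
        · by_cases hβd : β d = 0
          · exact hW.2 β ⟨0, by simp [hβd]⟩ x hx m hW.1
          · rw [hkill β h hβd x hx]
            exact W.zero_mem
        · obtain ⟨j, hj⟩ := h.exists_coeff hd
          exact hW.2 β ⟨j, by rw [← hj, LinearMap.neg_apply, neg_neg]⟩ x hx m hW.1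
      | zero => simp
      | add x y _ _ hx hy => rw [add_lie]; exact W.add_mem hx hy
    · rw [leibniz_lie]
      exact W.add_mem (hw.2 _) (hW.2 β hβ x hx _ (hw.2 y))
  let W' : LieSubmodule ℂ L M := { W with lie_mem := fun {x w} hw => ((hle U hU) hw).2 x }
  have : Nontrivial W' := (LieSubmodule.nontrivial_iff_ne_bot ..).2 fun h => hm0 <| by
    have : m ∈ W' := hW.1
    rw [h] at this
    simpa using this
  have hW' : W' = ⊤ := LieSubmodule.eq_top_of_isIrreducible ℂ L M W'
  let T : Set (H → ℂ) := {ψ | ∃ j : ℕ, ψ d = χ d - j}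
  -- The weight spaces with d-eigenvalue in χ(d) - ℕ also span a subspace satisfying `P`, so they
  -- exhaust M.
  have hG : P (⨆ ψ : T, (genWeightSpace M ψ.1).toSubmodule) := by
    refine ⟨Submodule.mem_iSup_of_mem (⟨χ, 0, by simp⟩ : T) hm, ?_⟩
    rintro β ⟨j, hj⟩ x hx w hw
    induction hw using Submodule.iSup_induction' with
    | mem ψ w hw =>
      obtain ⟨i, hi⟩ := ψ.2
      refine Submodule.mem_iSup_of_mem (⟨β + ψ.1, i + j, ?_⟩ : T)
        (lie_mem_genWeightSpace_of_mem_genWeightSpace hx hw)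
      rw [Pi.add_apply, hj, hi]
      push_cast
      ring
    | zero => simp
    | add a b _ _ ha hb => rw [lie_add]; exact Submodule.add_mem _ ha hb
  have hmem : m' ∈ ⨆ ψ ∈ T, (genWeightSpace M ψ).toSubmodule := by
    rw [iSup_subtype']
    refine hle _ hG ?_
    have : m' ∈ W' := by rw [hW']; simp
    exact this
  by_contra hcon
  have hdisj := (LieSubmodule.iSupIndep_toSubmodule.mpr
    (iSupIndep_genWeightSpace ℂ H M)).disjoint_biSup (x := χ') (y := T) hcon
  exact hm'0 (Submodule.disjoint_def.1 hdisj m' hm' hmem)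

/-- The component of weight `χ` of an element of `L` that maps weight vectors to vectors whose
weights differ by `χ`. -/
lemma exists_mem_rootSpace_lie_eq {κ : Type*} {V : κ → Type*} [∀ k, AddCommGroup (V k)]
    [∀ k, Module ℂ (V k)] [∀ k, LieRingModule L (V k)] [∀ k, LieModule ℂ L (V k)]
    {v w : ∀ k, V k} {lam : κ → H → ℂ} {χ : H → ℂ} (hv : ∀ k, v k ∈ genWeightSpace (V k) (lam k))
    (hw : ∀ k, w k ∈ genWeightSpace (V k) (χ + lam k)) {y : L} (hy : ∀ k, ⁅y, v k⁆ = w k) :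
    ∃ z ∈ rootSpace H χ, ∀ k, ⁅z, v k⁆ = w k := by
  classical
  have hy' : y ∈ ⨆ ψ : H → ℂ, (rootSpace H ψ).toSubmodule := by
    rw [← LieSubmodule.iSup_toSubmodule, iSup_genWeightSpace_eq_top ℂ H L]
    exact Submodule.mem_top
  obtain ⟨f, hf, hfy⟩ := (Submodule.mem_iSup_iff_exists_finsupp _ _).1 hy'
  refine ⟨f χ, hf χ, fun k => ?_⟩
  have hsum : w k - ⁅f χ, v k⁆ = ∑ ψ ∈ f.support.erase χ, ⁅f ψ, v k⁆ := by
    have h1 : y = f χ + ∑ ψ ∈ f.support.erase χ, f ψ := by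
      rw [← hfy, Finsupp.sum]
      by_cases h : χ ∈ f.support
      · rw [Finset.add_sum_erase _ _ h]
      · rw [Finset.erase_eq_of_notMem h, Finsupp.notMem_support_iff.1 h, zero_add]
    rw [← hy, h1, add_lie, add_sub_cancel_left, _root_.sum_lie]
  have hmem : w k - ⁅f χ, v k⁆ ∈ ⨆ ψ ∈ {ψ | ψ ≠ χ + lam k}, (genWeightSpace (V k) ψ).toSubmodule := by
    rw [hsum]
    refine Submodule.sum_mem _ fun ψ hψ => ?_
    refine Submodule.mem_iSup_of_mem (ψ + lam k) (Submodule.mem_iSup_of_mem ?_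
      (lie_mem_genWeightSpace_of_mem_genWeightSpace (hf ψ) (hv k)))
    exact fun h => (Finset.mem_erase.1 hψ).1 (add_right_cancel h)
  have hdisj := (LieSubmodule.iSupIndep_toSubmodule.mpr
    (iSupIndep_genWeightSpace ℂ H (V k))).disjoint_biSup (x := χ + lam k)
    (y := {ψ | ψ ≠ χ + lam k}) (by simp)
  have := Submodule.disjoint_def.1 hdisj _ (sub_mem (hw k)
    (lie_mem_genWeightSpace_of_mem_genWeightSpace (hf χ) (hv k))) hmem
  exact (sub_eq_zero.1 this).symm

/-- t_β is the coroot divided by a positive real q, and the highest weight is a natural number on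
the coroot. If that number is 0, the sl₂-module generated by m is trivial. -/
lemma IsHighestWeightVector.tVec_lie {M : Type*} [AddCommGroup M] [Module ℂ M] [LieRingModule L M]
    [LieModule ℂ L M] [FiniteDimensional ℂ M] {μ : Module.Dual ℂ H} {m : M}
    (hm : IsHighestWeightVector H S μ m) {β : Module.Dual ℂ H} (hβ : IsPositiveRoot H S β) :
    ∃ r : ℝ, 0 ≤ r ∧ ⁅tVec β, m⁆ = (r : ℂ) • m ∧ (r = 0 → ⁅fVec β, m⁆ = 0) := by
  obtain ⟨h, f, hf, hsl, -, q, hq, hqf⟩ := exists_sl2 hβ.1.1 (eVec_mem hβ.1) (eVec_ne_zero hβ.1)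
  obtain ⟨c, rfl⟩ := eq_smul_fVec hβ.1 hf
  have hcq : c = q := by
    rw [← hqf, map_smul, adjForm_eVec_fVec hβ.1, smul_eq_mul, mul_one]
  subst hcq
  have hq0 : (q : ℂ) ≠ 0 := by exact_mod_cast hq.ne'
  have hem : ⁅eVec β, m⁆ = 0 := hm.lie_eq_zero β hβ _ (eVec_mem hβ.1)
  have hhm : ⁅(h : L), m⁆ = μ h • m := (LieModule.mem_weightSpace _ _).1 hm.mem_weightSpace h
  obtain ⟨n, hn⟩ := exists_nat_of_lie_eq_zero hsl hm.ne_zero hhm hem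
  have hht : (h : L) = (q : ℂ) • tVec β := by rw [← hsl.lie_e_f, lie_smul, tVec]
  refine ⟨n / q, by positivity, ?_, fun h0 => ?_⟩
  · refine smul_right_injective M hq0 ?_
    change (q : ℂ) • _ = (q : ℂ) • _
    rw [← smul_lie, ← hht, hhm, hn, smul_smul]
    congr 1
    push_cast
    field_simp
  · have hn0 : (n : ℝ) = 0 := by
      rcases div_eq_zero_iff.1 h0 with h1 | h1
      · exact h1
      · exact absurd h1 hq.ne'
    have hn0' : n = 0 := by exact_mod_cast hn0
    have hfm := lie_eq_zero_of_weight_zero hsl (m := m) (by rw [hhm, hn, hn0']; simp) hem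
    rw [smul_lie] at hfm
    exact (smul_eq_zero.1 hfm).resolve_left hq0

/-- Subtracting z.v only changes the witness y to y - [e_β, z], because e_β kills v. -/
lemma IsTangentPair.sub_lie {M : Type*} [AddCommGroup M] [Module ℂ M] [LieRingModule L M]
    [LieModule ℂ L M] {α : ι} {γ : Module.Dual ℂ H} {v u : M} (hT : IsTangentPair S α γ v u)
    {z : L} (hz : z ∈ rootSpace H (-γ : Module.Dual ℂ H)) :
    IsTangentPair S α γ v (u - ⁅z, v⁆) where
  lie_eq_zero := hT.lie_eq_zero
  fVec_lie := hT.fVec_lie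
  tVec_lie := hT.tVec_lie
  exists_lie_eq β hβ hβα := by
    obtain ⟨y, hy, hyv⟩ := hT.exists_lie_eq β hβ hβα
    refine ⟨y - ⁅eVec β, z⁆, sub_mem hy ?_, ?_⟩
    · exact rootSpace_congr (sub_eq_add_neg _ _).symm (lie_mem_rootSpace (eVec_mem hβ.1) hz)
    · rw [lie_sub, hyv, leibniz_lie (eVec β) z v, hT.eVec_lie hβ, lie_zero, add_zero,
        _root_.sub_lie]

end Modules

/-! ### The sum of highest weight vectors in the direct sum -/

section DirectSum

variable {L : Type*} [LieRing L] [LieAlgebra ℂ L] [FiniteDimensional ℂ L]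
  {H : LieSubalgebra ℂ L} [H.IsCartanSubalgebra] [HasCentralRadical ℂ L]
  {ι : Type*} [Fintype ι] {S : ι → Module.Dual ℂ H}
  {s : ℕ} {lam : Fin s → Module.Dual ℂ H} {V : Fin s → Type*} [∀ k, AddCommGroup (V k)]
  [∀ k, Module ℂ (V k)] [∀ k, LieRingModule L (V k)] [∀ k, LieModule ℂ L (V k)]

lemma sumVector_apply (v : ∀ k, V k) (k : Fin s) : sumVector v k = v k := by
  rw [sumVector, DFinsupp.finsetSum_apply, Finset.sum_eq_single k]
  · exact DirectSum.of_eq_same k (v k)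
  · intro j _ hj
    exact DirectSum.of_eq_of_ne _ _ _ hj.symm
  · simp

lemma mem_orbitTangent {M : Type*} [AddCommGroup M] [Module ℂ M] [LieRingModule L M]
    [LieModule ℂ L M] {m w : M} : w ∈ orbitTangent L m ↔ ∃ y : L, ⁅y, m⁆ = w :=
  Iff.rfl

/-- The scalars by which t_β acts on the summands are nonnegative reals, so no cancellation occurs.
The element of L produced by `hkill` is replaced by its component of weight β - γ, which works in
all summands at once. -/
lemma isTangentPair_sumVector [∀ k, FiniteDimensional ℂ (V k)] {vlam : ∀ k, V k}
    (hvlam : ∀ k, IsHighestWeightVector H S (lam k) (vlam k))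
    {γ : Module.Dual ℂ H} {vγ : DirectSum (Fin s) V}
    (hvγ : ∀ k, vγ k ∈ LieModule.weightSpace (V k) (lam k - γ : H → ℂ)) {α : ι}
    (hkill : ∀ β, IsPositiveRoot H S β → β ≠ S α → ∀ x ∈ LieAlgebra.rootSpace H β,
      (orbitTangent L (sumVector vlam)).mkQ ⁅x, vγ⁆ = 0) :
    IsTangentPair S α γ (sumVector vlam) vγ where
  lie_eq_zero β hβ x hx := by
    refine DFinsupp.ext fun k => ?_
    rw [DirectSum.lie_module_bracket_apply, sumVector_apply]
    exact (hvlam k).lie_eq_zero β hβ x hx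
  fVec_lie β hβ h := by
    refine DFinsupp.ext fun k => ?_
    obtain ⟨r, hr, h1, h2⟩ := (hvlam k).tVec_lie hβ
    have h3 := DFunLike.congr_fun h k
    rw [DirectSum.lie_module_bracket_apply, sumVector_apply] at h3 ⊢
    rw [h1] at h3
    exact h2 (by exact_mod_cast (smul_eq_zero.1 h3).resolve_right (hvlam k).ne_zero)
  tVec_lie β β' hβ hβ' h := by
    refine DFinsupp.ext fun k => ?_
    obtain ⟨r, hr, h1, -⟩ := (hvlam k).tVec_lie hβ
    obtain ⟨r', hr', h1', -⟩ := (hvlam k).tVec_lie hβ'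
    have h3 := DFunLike.congr_fun h k
    rw [DirectSum.add_apply, DirectSum.lie_module_bracket_apply,
      DirectSum.lie_module_bracket_apply, sumVector_apply, h1, h1', ← add_smul] at h3
    have h4 : r + r' = 0 := by
      exact_mod_cast (smul_eq_zero.1 h3).resolve_right (hvlam k).ne_zero
    rw [DirectSum.lie_module_bracket_apply, sumVector_apply, h1,
      show r = 0 by linarith]
    simp
  exists_lie_eq β hβ hβα := by
    have h1 := hkill β hβ hβα _ (eVec_mem hβ.1)
    rw [Submodule.mkQ_apply, Submodule.Quotient.mk_eq_zero, mem_orbitTangent] at h1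
    obtain ⟨y, hy⟩ := h1
    have hy' : ∀ k, ⁅y, vlam k⁆ = ⁅eVec β, vγ⁆ k := fun k => by
      rw [← hy, DirectSum.lie_module_bracket_apply, sumVector_apply]
    obtain ⟨z, hz, hzv⟩ := exists_mem_rootSpace_lie_eq (χ := (β - γ : Module.Dual ℂ H))
      (lam := fun k => lam k) (v := vlam)
      (fun k => weightSpace_le_genWeightSpace _ _ (hvlam k).mem_weightSpace) (fun k => by
        have h2 := lie_mem_genWeightSpace_of_mem_genWeightSpace (eVec_mem hβ.1)
          (weightSpace_le_genWeightSpace _ _ (hvγ k))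
        rw [DirectSum.lie_module_bracket_apply]
        convert h2 using 2
        ext t
        simp only [Pi.add_apply, Pi.sub_apply, LinearMap.sub_apply]
        ring) hy'
    refine ⟨z, hz, DFinsupp.ext fun k => ?_⟩
    rw [← hzv, DirectSum.lie_module_bracket_apply, sumVector_apply]

lemma isOrthogonal_of_tVec_lie {M : Type*} [AddCommGroup M] [Module ℂ M] [LieRingModule L M]
    [LieModule ℂ L M] {μ β : Module.Dual ℂ H} {m : M}
    (hm : IsHighestWeightVector H S μ m) (hβ : IsRoot H β) (h : ⁅tVec β, m⁆ = 0) :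
    IsOrthogonal H μ β := by
  intro x hx
  rw [mem_corootSpace] at hx
  have hle : Submodule.span ℂ {z | ∃ y ∈ rootSpace H β,
      ∃ w ∈ rootSpace H (-β : H → ℂ), ⁅y, w⁆ = z} ≤ Submodule.span ℂ {tVec β} := by
    rw [Submodule.span_le]
    rintro _ ⟨y, hy, w, hw, rfl⟩
    obtain ⟨a, rfl⟩ := eq_smul_eVec hβ hy
    obtain ⟨b, rfl⟩ := eq_smul_fVec hβ hw
    rw [lie_smul, smul_lie]
    exact Submodule.smul_mem _ _ (Submodule.smul_mem _ _ (Submodule.mem_span_singleton_self _))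
  obtain ⟨c, hc⟩ := Submodule.mem_span_singleton.1 (hle hx)
  have h1 : ⁅(x : L), m⁆ = μ x • m := (LieModule.mem_weightSpace _ _).1 hm.mem_weightSpace x
  rw [← hc, smul_lie, h, smul_zero] at h1
  exact (smul_eq_zero.1 h1.symm).resolve_right hm.ne_zero

end DirectSum

end ReductivePair

/-! ### The main theorem -/

theorem mainTheorem11
    {L : Type*} [LieRing L] [LieAlgebra ℂ L] [FiniteDimensional ℂ L]
    [LieAlgebra.HasCentralRadical ℂ L]
    (H : LieSubalgebra ℂ L) [H.IsCartanSubalgebra]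
    (Λ : AddSubgroup (Module.Dual ℂ H)) (hΛ : IsCharacterLattice H Λ)
    {ι : Type*} [Fintype ι] (S : ι → Module.Dual ℂ H) (hS : IsSimpleSystem H S)
    -- linearly independent dominant weights spanning a saturated monoid
    {s : ℕ} (lam : Fin s → Module.Dual ℂ H)
    (hlam_dom : ∀ k, lam k ∈ dominantWeights H Λ S)
    (hlam_ind : LinearIndependent ℤ lam)
    (hlam_sat : (AddSubgroup.closure (Set.range lam) : Set (Module.Dual ℂ H)) ∩
      dominantWeights H Λ S = AddSubmonoid.closure (Set.range lam))
    -- the irreducible modules with these highest weights, and highest weight vectors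
    {V : Fin s → Type*} [∀ k, AddCommGroup (V k)] [∀ k, Module ℂ (V k)]
    [∀ k, LieRingModule L (V k)] [∀ k, LieModule ℂ L (V k)]
    [∀ k, FiniteDimensional ℂ (V k)] [∀ k, LieModule.IsIrreducible ℂ L (V k)]
    (vlam : ∀ k, V k) (hvlam : ∀ k, IsHighestWeightVector H S (lam k) (vlam k))
    -- a weight vector of weight `γ` for the adjoint torus in the quotient of `V` by `L.v`
    (γ : Module.Dual ℂ H) (vγ : DirectSum (Fin s) V)
    (hvγ : ∀ k, vγ k ∈ LieModule.weightSpace (V k) (lam k - γ : H → ℂ))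
    (hvγ_ne : (orbitTangent L (sumVector vlam)).mkQ vγ ≠ 0)
    (α δ : ι) (hαδ : IsOrthogonal H (S α) (S δ))
    (hδ : δ ∈ rootSupport H S γ)
    (hγδ_ne : γ ≠ S δ) (hγδ : ¬ IsRoot H (γ - S δ))
    (hkill : ∀ β, IsPositiveRoot H S β → β ≠ S α → ∀ x ∈ LieAlgebra.rootSpace H β,
      (orbitTangent L (sumVector vlam)).mkQ ⁅x, vγ⁆ = 0) :
    ∀ k, IsOrthogonal H (lam k) (S δ) := by
  classical
  have hT := isTangentPair_sumVector hvlam hvγ hkill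
  obtain ⟨d, hd⟩ := hS.exists_apply_eq fun j => if j = δ then 1 else 0
  have hγd : ∃ n : ℤ, n ≠ 0 ∧ γ d = n := by
    obtain ⟨n, hn, hnδ⟩ := hδ
    exact ⟨n δ, hnδ, by rw [hn, LinearMap.sum_apply]; simp [hd]⟩
  obtain ⟨n, hn0, hn⟩ := hγd
  by_contra hcon
  have hδv : ⁅tVec (S δ), sumVector vlam⁆ ≠ 0 := fun h0 => hcon fun k => by
    refine isOrthogonal_of_tVec_lie (hvlam k) (hS.isRoot δ) ?_
    have := DFunLike.congr_fun h0 k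
    rwa [DirectSum.lie_module_bracket_apply, sumVector_apply] at this
  -- Change the representative so that e_γ kills it when γ is a positive root; e_γ f_γ v = t_γ v
  -- dictates the multiple of f_γ.
  obtain ⟨z, hz, hzγ⟩ : ∃ z ∈ LieAlgebra.rootSpace H (-γ : Module.Dual ℂ H),
      IsPositiveRoot H S γ → ⁅eVec γ, vγ - ⁅z, sumVector vlam⁆⁆ = 0 := by
    by_cases hγ : IsPositiveRoot H S γ
    · obtain ⟨c, hc⟩ := hT.exists_eVec_lie_eq_smul_tVec_lie hS hαδ hd hδv hγ
        (by rw [hn]; exact_mod_cast hn0) hγδ_ne hγδ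
      refine ⟨c • fVec γ, (LieAlgebra.rootSpace H _).smul_mem c (fVec_mem hγ.1), fun _ => ?_⟩
      rw [lie_sub, hc, smul_lie, lie_smul, hT.eVec_lie_fVec_lie hγ, sub_self]
    · exact ⟨0, zero_mem _, fun h => absurd h hγ⟩
  have hT' := hT.sub_lie hz
  refine hvγ_ne ?_
  rw [Submodule.mkQ_apply, Submodule.Quotient.mk_eq_zero, mem_orbitTangent]
  refine ⟨z, (sub_eq_zero.1 (DFinsupp.ext fun k => ?_)).symm⟩
  by_contra hk
  have hmem : (vγ - ⁅z, sumVector vlam⁆) k ∈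
      LieModule.genWeightSpace (V k) (lam k - γ : H → ℂ) := by
    rw [DirectSum.sub_apply, DirectSum.lie_module_bracket_apply, sumVector_apply]
    refine sub_mem (LieModule.weightSpace_le_genWeightSpace _ _ (hvγ k)) ?_
    have := LieAlgebra.lie_mem_genWeightSpace_of_mem_genWeightSpace hz
      (LieModule.weightSpace_le_genWeightSpace _ _ (hvlam k).mem_weightSpace)
    convert this using 2
    ext t
    simp only [Pi.add_apply, Pi.sub_apply, LinearMap.neg_apply]
    ring
  have hvk := LieModule.weightSpace_le_genWeightSpace _ _ (hvlam k).mem_weightSpace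
  -- Each of the two vectors bounds the d-eigenvalue of the other, giving n = -i here and n = j
  -- below, hence n = 0.
  obtain ⟨i, hi⟩ := exists_nat_of_isIrreducible hS hd hmem hk (fun β hβ hβd x hx => by
    obtain ⟨c, rfl⟩ := eq_smul_eVec hβ.1 hx
    have := DFunLike.congr_fun
      (hT'.eVec_lie_eq_zero_of_coeff_ne_zero hS hαδ hd hδv hγδ_ne hγδ hzγ hβ hβd) k
    rw [DirectSum.lie_module_bracket_apply] at this
    rw [smul_lie, this]
    exact smul_zero c) hvk (hvlam k).ne_zero
  obtain ⟨j, hj⟩ := exists_nat_of_isIrreducible hS hd hvk (hvlam k).ne_zero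
    (fun β hβ _ x hx => (hvlam k).lie_eq_zero β hβ x hx) hmem hk
  rw [Pi.sub_apply, hn] at hi hj
  have h1 : n = -i := by
    have : (n : ℂ) = ((-i : ℤ) : ℂ) := by push_cast; linear_combination hi
    exact_mod_cast this
  have h2 : n = j := by
    have : (n : ℂ) = ((j : ℤ) : ℂ) := by push_cast; linear_combination -hj
    exact_mod_cast this
  omega
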